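/- Let $E=(E^0,E^1,r,s)$ be a finite directed graph (loops and multiple edges allowed) with no sources and no sinks, i.e. every vertex is $r(e)$ for some edge $e$ and $s(e')$ for some edge $e'$, and let $n\ge 1$. Let $E^*$ be the set of finite paths of $E$, written $w=e_k\cdots e_1$ with $s(e_{i+1})=r(e_i)$, and including the vertices as paths of length $0$; put $s(w)=s(e_1)$, $r(w)=r(e_k)$, $|w|=k$ (and $s(x)=r(x)=x$ for a vertex $x$). Let $E^{<n}$ be the set of paths of length less than $n$. Every $w\in E^*$ factors uniquely as $w=w(n)\,v_k\cdots v_1$ with $|v_i|=n$ and $w(n)\in E^{<n}$. Let $\mathcal H_E=\ell^2(E^*)$ with its standard orthonormal basis $\{\xi_w\}_{w\in E^*}$. A family $(T_e)_{e\in E^1}$ of bounded operators on $\mathcal H_E$ is a weighted shift with weights $\lambda(w)\in\mathbb C$ ($|w|\ge 1$) if $T_e\xi_w=\lambda(ew)\,\xi_{ew}$ when $s(e)=r(w)$ and $T_e\xi_w=0$ otherwise. It is $n$-periodic if $\lambda(ew)=\lambda(e\,w(n))$ for all $e\in E^1$ and $w\in E^*$ with $s(e)=r(w)$; thus it is determined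 by the weights of the paths of length between $1$ and $n$. Let $\mathcal A(n)$ be the C$^*$-subalgebra of $\mathcal B(\mathcal H_E)$ generated by the operators $T_e$, $e\in E^1$, of all $n$-periodic weighted shifts. Let $E(n)$ be the graph with vertex set $E^{<n}$ and edge set $\{(e,w)\in E^1\times E^{<n}: s(e)=r(w)\}$, where $(e,w)$ has source $w$, and has range $ew$ if $|w|<n-1$ and range $r(e)\in E^0\subseteq E^{<n}$ if $|w|=n-1$. Let $c(E^0)=\{c(v):v\in E^0\}$ be a disjoint copy of $E^0$. The graph $E[n]$ has vertex set $E^{<n}\sqcup c(E^0)$ and edge set $E(n)^1\sqcup\{(e,c(v)): e\in E^1,\ v\in E^0,\ s(e)=v\}$; the edges of $E(n)$ keep their source and range, and $(e,c(v))$ has source $c(v)$, and has range the path $e\in E^{<n}$ if $n>1$ and range $r(e)$ if $n=1$. For a finite directed graph $G$, a Cuntz--Krieger $G$-family in a C$^*$-algebra consists of mutually orthogonal projections $P_x$ ($x\in G^0$) and partial isometries $S_e$ ($e\in G^1$) with $S_e^*S_f=0$ for $e\ne f$, $S_e^*S_e=P_{s(e)}$, and $\sum_{r(e)=x}S_eS_e^*=P_x$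 for every vertex $x$ with $r^{-1}(x)\neq\emptyset$. Let $\mathcal O(G)$ be the universal C$^*$-algebra generated by a Cuntz--Krieger $G$-family. Theorem. The C$^*$-algebra $\mathcal A(n)$ is $*$-isomorphic to the graph algebra $\mathcal O(E[n])$. -/

import Mathlib

open scoped ENNReal

noncomputable section

universe u w

/-! ### Directed graphs and their finite paths -/

/-- A directed graph `(E⁰, E¹, r, s)`; loops and multiple edges are allowed. -/
structure DirGraph : Type (u + 1) where
  /-- vertices -/
  Vert : Type u
  /-- edges -/
  Edge : Type u
  /-- range (final vertex) of an edge -/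
  r : Edge → Vert
  /-- source (initial vertex) of an edge -/
  s : Edge → Vert

namespace DirGraph

variable (E : DirGraph.{u})

/-- Every vertex is the final vertex of some edge. -/
def NoSources : Prop := ∀ x : E.Vert, ∃ e : E.Edge, E.r e = x

/-- Every vertex is the initial vertex of some edge. -/
def NoSinks : Prop := ∀ x : E.Vert, ∃ e : E.Edge, E.s e = x

variable {E} in
/-- Final vertex of the walk which starts at `x` and whose edges, listed from the last one walked
to the first one walked, are `l`. -/
def walkRange (x : E.Vert) : List E.Edge → E.Vert
  | [] => x
  | e :: _ => E.r e

variable {E} in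
/-- `IsWalk x [eₖ, …, e₁]`: walking along `e₁`, then `e₂`, …, then `eₖ`, starting at `x`, is
possible. -/
def IsWalk (x : E.Vert) : List E.Edge → Prop
  | [] => True
  | e :: l => E.s e = walkRange x l ∧ IsWalk x l

/-- The set `E*` of finite paths `eₖ ⋯ e₁`, with `s(eᵢ₊₁) = r(eᵢ)`, including the vertices as
paths of length `0`. The edges are listed in the order `eₖ, …, e₁` in which the path is written. -/
@[ext]
structure Path where
  /-- initial vertex of the path -/
  src : E.Vert
  /-- edges of the path, the last one walked coming first -/
  edges : List E.Edge
  isWalk : IsWalk src edges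

variable {E}

namespace Path

/-- The final vertex `r(w)`. -/
def range (w : E.Path) : E.Vert := walkRange w.src w.edges

/-- The length `|w|`. -/
def length (w : E.Path) : ℕ := w.edges.length

/-- A vertex as a path of length `0`. -/
def nil (x : E.Vert) : E.Path := ⟨x, [], trivial⟩

/-- The path `ew`, where `s(e) = r(w)`: first `w`, then `e`. -/
def cons (e : E.Edge) (w : E.Path) (h : E.s e = w.range) : E.Path := ⟨w.src, e :: w.edges, h, w.isWalk⟩

end Path

theorem isWalk_take (x : E.Vert) (k : ℕ) (l : List E.Edge) (h : IsWalk x l) :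
    IsWalk (walkRange x (l.drop k)) (l.take k) := by
  induction l generalizing k with
  | nil => cases k <;> trivial
  | cons e l ih =>
    cases k with
    | zero => trivial
    | succ k =>
      refine ⟨?_, ih k h.2⟩
      rw [h.1]
      cases l <;> cases k <;> rfl

theorem walkRange_take (x : E.Vert) (k : ℕ) (l : List E.Edge) :
    walkRange (walkRange x (l.drop k)) (l.take k) = walkRange x l := by
  cases l <;> cases k <;> rfl

namespace Path

/-- The remainder `w(n)` in the unique factorization `w = w(n) vₖ ⋯ v₁` with `|vᵢ| = n` and
`|w(n)| < n` (for `n ≥ 1`): it consists of the last `|w| mod n` edges walked. -/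
def rem (n : ℕ) (w : E.Path) : E.Path where
  src := walkRange w.src (w.edges.drop (w.length % n))
  edges := w.edges.take (w.length % n)
  isWalk := isWalk_take _ _ _ w.isWalk

theorem range_rem (n : ℕ) (w : E.Path) : (w.rem n).range = w.range := walkRange_take _ _ _

end Path

/-! ### The graphs `E(n)` and `E[n]` -/

variable (E)

/-- The graph `E(n)`: its vertices are the paths of length `< n`, its edges are the pairs `(e, w)`
with `w` such a path and `s(e) = r(w)`; the source of `(e, w)` is `w`, its range is `ew` if
`|w| < n - 1` and the vertex `r(e)` if `|w| = n - 1`. -/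
def periodGraph (n : ℕ) [NeZero n] : DirGraph.{u} where
  Vert := {w : E.Path // w.length < n}
  Edge := {p : E.Edge × {w : E.Path // w.length < n} // E.s p.1 = p.2.1.range}
  s p := p.1.2
  r p :=
    if h : p.1.2.1.length + 1 < n then ⟨Path.cons p.1.1 p.1.2.1 p.2, h⟩
    else ⟨Path.nil (E.r p.1.1), NeZero.pos n⟩

/-- The graph `E[n]`: to the vertices of `E(n)` one adds a copy `c(E⁰)` of `E⁰` (the second
summand), to the edges of `E(n)` one adds the pairs `(e, c(v))` with `s(e) = v`. The source of
`(e, c(v))` is `c(v)`, its range is the path `e` of length one if `n > 1` and the vertex `r(e)`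
if `n = 1`. -/
def augPeriodGraph (n : ℕ) [NeZero n] : DirGraph.{u} where
  Vert := (E.periodGraph n).Vert ⊕ E.Vert
  Edge := (E.periodGraph n).Edge ⊕ {p : E.Edge × E.Vert // E.s p.1 = p.2}
  s z := match z with
    | .inl p => .inl ((E.periodGraph n).s p)
    | .inr p => .inr p.1.2
  r z := match z with
    | .inl p => .inl ((E.periodGraph n).r p)
    | .inr p => .inl <|
        if h : 1 < n then ⟨Path.cons p.1.1 (Path.nil p.1.2) p.2, h⟩
        else ⟨Path.nil (E.r p.1.1), NeZero.pos n⟩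

instance finite_path_lt [Finite E.Vert] [Finite E.Edge] (n : ℕ) :
    Finite {w : E.Path // w.length < n} := by
  have : Finite {l : List E.Edge // l.length < n} := (List.finite_length_lt E.Edge n).to_subtype
  refine Finite.of_injective
    (fun w => ((w.1.src, ⟨w.1.edges, w.2⟩) : E.Vert × {l : List E.Edge // l.length < n})) ?_
  intro a b hab
  simp only [Prod.mk.injEq] at hab
  exact Subtype.ext (Path.ext hab.1 (congrArg Subtype.val hab.2))

instance finite_augPeriodGraph_vert [Finite E.Vert] [Finite E.Edge] (n : ℕ) [NeZero n] :
    Finite (E.augPeriodGraph n).Vert :=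
  inferInstanceAs (Finite ({w : E.Path // w.length < n} ⊕ E.Vert))

instance finite_augPeriodGraph_edge [Finite E.Vert] [Finite E.Edge] (n : ℕ) [NeZero n] :
    Finite (E.augPeriodGraph n).Edge :=
  inferInstanceAs (Finite
    ({p : E.Edge × {w : E.Path // w.length < n} // E.s p.1 = p.2.1.range} ⊕
      {p : E.Edge × E.Vert // E.s p.1 = p.2}))

/-! ### Cuntz–Krieger families and the graph algebra `𝒪(G)` -/

section GraphAlgebra

variable (G : DirGraph.{u}) [Finite G.Edge]

/-- `{Pₓ, Sₑ}` is a Cuntz–Krieger `G`-family in the C⋆-algebra `B`. That the `Sₑ` are partial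
isometries is part of `star_mul_self`; at a vertex with `r⁻¹(x) = ∅` the fourth relation of a
Toeplitz–Cuntz–Krieger family is `0 ≤ Pₓ`, which holds for every projection. -/
structure IsCKFamily {B : Type w} [NonUnitalCStarAlgebra B] (P : G.Vert → B) (S : G.Edge → B) :
    Prop where
  isProj : ∀ x, IsStarProjection (P x)
  orthogonal : ∀ x y, x ≠ y → P x * P y = 0
  star_mul : ∀ e f, e ≠ f → star (S e) * S f = 0
  star_mul_self : ∀ e, star (S e) * S e = P (G.s e)
  sum_mul_star : ∀ x, (∃ e, G.r e = x) →
    ∑ e ∈ (Set.toFinite {e | G.r e = x}).toFinset, S e * star (S e) = P x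

/-- A C⋆-algebra together with a Cuntz–Krieger `G`-family in it. -/
structure CKRep : Type (u + 1) where
  /-- the C⋆-algebra -/
  alg : Type u
  [inst : NonUnitalCStarAlgebra alg]
  /-- the projections -/
  P : G.Vert → alg
  /-- the partial isometries -/
  S : G.Edge → alg
  isCK : G.IsCKFamily P S

attribute [instance] CKRep.inst

variable {G}

theorem IsCKFamily.norm_proj_le {B : Type w} [NonUnitalCStarAlgebra B] {P : G.Vert → B}
    {S : G.Edge → B} (h : G.IsCKFamily P S) (x : G.Vert) : ‖P x‖ ≤ 1 :=
  (h.isProj x).norm_le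

theorem IsCKFamily.norm_isom_le {B : Type w} [NonUnitalCStarAlgebra B] {P : G.Vert → B}
    {S : G.Edge → B} (h : G.IsCKFamily P S) (e : G.Edge) : ‖S e‖ ≤ 1 := by
  have h1 := CStarRing.norm_star_mul_self (x := S e)
  rw [h.star_mul_self] at h1
  have h2 := h.norm_proj_le (G.s e)
  nlinarith [norm_nonneg (S e)]

variable (G)

/-- The C⋆-algebraic direct product (bounded families, supremum norm) of the C⋆-algebras of all
Cuntz–Krieger `G`-families. -/
def CKProd : Type (u + 1) := lp (fun ρ : G.CKRep => ρ.alg) ∞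

instance : NonUnitalCStarAlgebra G.CKProd :=
  inferInstanceAs (NonUnitalCStarAlgebra (lp (fun ρ : G.CKRep => ρ.alg) ∞))

/-- The generator `pₓ` of `𝒪(G)`: the bounded family of all `Pₓ`, over all Cuntz–Krieger families. -/
def univP (x : G.Vert) : G.CKProd :=
  ⟨fun ρ => ρ.P x, memℓp_infty ⟨1, by rintro _ ⟨ρ, rfl⟩; exact ρ.isCK.norm_proj_le x⟩⟩

/-- The generator `sₑ` of `𝒪(G)`: the bounded family of all `Sₑ`, over all Cuntz–Krieger families. -/
def univS (e : G.Edge) : G.CKProd :=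
  ⟨fun ρ => ρ.S e, memℓp_infty ⟨1, by rintro _ ⟨ρ, rfl⟩; exact ρ.isCK.norm_isom_le e⟩⟩

variable {G} in
/-- The coordinate projection of the direct product. -/
def CKProd.coord (ρ : G.CKRep) : G.CKProd →⋆ₙₐ[ℂ] ρ.alg where
  toFun a := (show lp (fun ρ : G.CKRep => ρ.alg) ∞ from a) ρ
  map_smul' _ _ := rfl
  map_zero' := rfl
  map_add' _ _ := rfl
  map_mul' _ _ := rfl
  map_star' _ := rfl

variable {G} in
theorem CKProd.ext_coord {a b : G.CKProd} (h : ∀ ρ, CKProd.coord ρ a = CKProd.coord ρ b) :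
    a = b :=
  lp.ext (E := fun ρ : G.CKRep => ρ.alg) (p := ∞) (funext h)

/-- The graph algebra `𝒪(G) = C⋆(G)`: the universal C⋆-algebra generated by a Cuntz–Krieger
`G`-family, realized as the C⋆-algebra generated by the direct sum of all Cuntz–Krieger
`G`-families. -/
def graphAlgebra : NonUnitalStarSubalgebra ℂ G.CKProd :=
  (NonUnitalStarAlgebra.adjoin ℂ (Set.range G.univP ∪ Set.range G.univS)).topologicalClosure

/-- The generators of `𝒪(G)` form a Cuntz–Krieger `G`-family. -/
theorem isCKFamily_univ : G.IsCKFamily G.univP G.univS where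
  isProj x :=
    ⟨CKProd.ext_coord fun ρ => (ρ.isCK.isProj x).isIdempotentElem,
      CKProd.ext_coord fun ρ => (ρ.isCK.isProj x).isSelfAdjoint⟩
  orthogonal x y h := CKProd.ext_coord fun ρ => ρ.isCK.orthogonal x y h
  star_mul e f h := CKProd.ext_coord fun ρ => ρ.isCK.star_mul e f h
  star_mul_self e := CKProd.ext_coord fun ρ => ρ.isCK.star_mul_self e
  sum_mul_star x h := CKProd.ext_coord fun ρ => by
    rw [map_sum]
    exact ρ.isCK.sum_mul_star x h

theorem univP_mem (x : G.Vert) : G.univP x ∈ G.graphAlgebra :=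
  NonUnitalStarSubalgebra.le_topologicalClosure _
    (NonUnitalStarAlgebra.subset_adjoin ℂ _ (Or.inl ⟨x, rfl⟩))

theorem univS_mem (e : G.Edge) : G.univS e ∈ G.graphAlgebra :=
  NonUnitalStarSubalgebra.le_topologicalClosure _
    (NonUnitalStarAlgebra.subset_adjoin ℂ _ (Or.inr ⟨e, rfl⟩))

/-- The universal property of `𝒪(G)`. -/
theorem exists_hom_of_isCKFamily {B : Type u} [NonUnitalCStarAlgebra B] {P : G.Vert → B}
    {S : G.Edge → B} (h : G.IsCKFamily P S) :
    ∃ φ : G.graphAlgebra →⋆ₙₐ[ℂ] B,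
      (∀ x, φ ⟨G.univP x, G.univP_mem x⟩ = P x) ∧
      (∀ e, φ ⟨G.univS e, G.univS_mem e⟩ = S e) :=
  ⟨(CKProd.coord ⟨B, P, S, h⟩).comp (NonUnitalStarSubalgebraClass.subtype G.graphAlgebra),
    fun _ => rfl, fun _ => rfl⟩

end GraphAlgebra

/-! ### Weighted shifts and the algebra `𝒜(n)` -/

/-- The Hilbert space `ℓ²(E*)`. -/
def FockSpace : Type u := lp (fun _ : E.Path => ℂ) 2

instance : NormedAddCommGroup E.FockSpace :=
  inferInstanceAs (NormedAddCommGroup (lp (fun _ : E.Path => ℂ) 2))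

instance : InnerProductSpace ℂ E.FockSpace :=
  inferInstanceAs (InnerProductSpace ℂ (lp (fun _ : E.Path => ℂ) 2))

instance : CompleteSpace E.FockSpace :=
  inferInstanceAs (CompleteSpace (lp (fun _ : E.Path => ℂ) 2))

variable {E}

open Classical in
/-- The basis vector `ξ_w`. -/
def xi (w : E.Path) : E.FockSpace :=
  (lp.single 2 w (1 : ℂ) : lp (fun _ : E.Path => ℂ) 2)

/-- `(Tₑ)` is the weighted shift on `ℓ²(E*)` with weights `lam`: `Tₑ ξ_w = lam(ew) ξ_{ew}`, which
is `0` if `s(e) ≠ r(w)`. The values of `lam` at paths of length `0` play no role. -/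
def IsWeightedShift (lam : E.Path → ℂ) (T : E.Edge → (E.FockSpace →L[ℂ] E.FockSpace)) : Prop :=
  ∀ (e : E.Edge) (w : E.Path),
    (∀ h : E.s e = w.range, T e (xi w) = lam (w.cons e h) • xi (w.cons e h)) ∧
    (E.s e ≠ w.range → T e (xi w) = 0)

/-- The weights are `n`-periodic: `lam(ew) = lam(e w(n))`, so that they are determined by the
remainder weights `lam(v)`, `1 ≤ |v| ≤ n`. -/
def IsPeriodic (n : ℕ) (lam : E.Path → ℂ) : Prop :=
  ∀ (e : E.Edge) (w : E.Path) (h : E.s e = w.range),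
    lam (w.cons e h) = lam ((w.rem n).cons e (h.trans (w.range_rem n).symm))

variable (E)

/-- The C⋆-algebra `𝒜(n)` of operators on `ℓ²(E*)` generated by the `Tₑ` of all `n`-periodic
weighted shifts. -/
def shiftAlgebra (n : ℕ) : NonUnitalStarSubalgebra ℂ (E.FockSpace →L[ℂ] E.FockSpace) :=
  (NonUnitalStarAlgebra.adjoin ℂ
    {A | ∃ (lam : E.Path → ℂ) (T : E.Edge → (E.FockSpace →L[ℂ] E.FockSpace)) (e : E.Edge),
      IsPeriodic n lam ∧ IsWeightedShift lam T ∧ A = T e}).topologicalClosure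

end DirGraph

end

/-! An `n`-periodic shift splits over the edges p = (e, w(n)) of E(n), so 𝒜(n) is generated by the
elementary shifts ξ_w ↦ ξ_{ew}, one for each p (`shiftAlgebra_eq`). In 𝒪(E[n]) put V_p = S_p, plus
S_{(e,c(v))} when p starts at a vertex v of length zero. These form a Toeplitz family for E(n):
V_p⋆V_p is the projection R at the source of p, and the V_pV_p⋆ with range x add up to R_x − Q_x,
where the defect Q_x is P_{c(v)} if x = v has length zero and 0 otherwise. They generate 𝒪(E[n])
(`IsCKFamily.isToeplitzFamily`, `IsCKFamily.adjoin_le`). On ℓ²(E*), giving the path v to c(v) and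
every longer path to its remainder defines a Cuntz–Krieger E[n]-family whose V_p is the elementary
shift (`isCKFamily_fock`, `edgeElt_fockS`). The resulting representation Φ maps generators to
generators, and only its isometry remains.

Isometry comes from a Fejér-type averaging. For a path z let A_z and C_z be the product of the V's
along z, multiplied on the right by Q and by R − Q at the source. V_p and V_p⋆ move these words as
the shift and its adjoint move ξ_z, except that V_p⋆ need not kill the C_v with v a vertex. A row
b_z = a_k A_z + c_k C_z, k = |z|, defines F(x) = ∑ ⟨ξ_u, x ξ_y⟩ b_u b_y⋆. With a_k² = N − ⌊k/n⌋ and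
c_k = 1 for k < nN, a telescoping identity gives ∑ b_z b_z⋆ = N ∑ R_x (`sum_weighted_levelSum`), so
‖F_N(x)‖ ≤ N‖x‖ by Cauchy–Schwarz. Since a_k varies slowly and c_k jumps only once, F_N(Tx) − V_p
F_N(x) is of order √N for the shift T of p, and likewise for adjoints. Hence N⁻¹F_N(Φ(a)) → a on the
⋆-algebra generated by the V_p, and ‖a‖ ≤ ‖Φ(a)‖ (`IsToeplitzFamily.norm_le_of_map_edge`). -/

/-! ### Cauchy–Schwarz estimates for rows over a C⋆-algebra -/

section CStarCauchySchwarz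

open scoped CStarAlgebra WithCStarModule

variable {B : Type*} [NonUnitalCStarAlgebra B]

/-- Cauchy–Schwarz inequality for rows over a C⋆-algebra. -/
theorem norm_sum_mul_sq_le {ι : Type*} [Fintype ι] (d y : ι → B) :
    ‖∑ i, d i * y i‖ ^ 2 ≤ ‖∑ i, d i * star (d i)‖ * ‖∑ i, star (y i) * y i‖ := by
  let _ := CStarAlgebra.spectralOrder B
  have _ := CStarAlgebra.spectralOrderedRing B
  -- The inner product of `B` over itself is ⟪x, y⟫ = y * star x, so the entries `star (y i)` turn
  -- it into `d i * y i`.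
  let X : C⋆ᵐᵒᵈ(B, ι → B) := (WithCStarModule.equiv B (ι → B)).symm fun i => star (y i)
  let Y : C⋆ᵐᵒᵈ(B, ι → B) := (WithCStarModule.equiv B (ι → B)).symm d
  have h := CStarModule.norm_inner_le (A := B) (E := C⋆ᵐᵒᵈ(B, ι → B)) (x := X) (y := Y)
  have hX := WithCStarModule.pi_norm_sq (A := B) X
  have hY := WithCStarModule.pi_norm_sq (A := B) Y
  have e1 : inner B X Y = ∑ i, d i * y i := by
    rw [WithCStarModule.pi_inner]
    refine Finset.sum_congr rfl fun i _ => ?_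
    simp [X, Y, WithCStarModule.inner_def]
  have e2 : ∑ i, inner B (X i) (X i) = ∑ i, star (y i) * y i := by
    refine Finset.sum_congr rfl fun i _ => ?_
    simp [X, WithCStarModule.inner_def]
  have e3 : ∑ i, inner B (Y i) (Y i) = ∑ i, d i * star (d i) := by
    refine Finset.sum_congr rfl fun i _ => ?_
    simp [Y, WithCStarModule.inner_def]
  rw [e1] at h
  rw [e2] at hX
  rw [e3] at hY
  rw [← hX, ← hY, ← mul_pow, mul_comm]
  exact pow_le_pow_left₀ (norm_nonneg _) h 2

open Matrix MatrixOrder ComplexOrder in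
/-- A scalar matrix `X` with `‖X v‖ ≤ M ‖v‖` maps rows over a C⋆-algebra to rows of at most `M`
times the norm. -/
theorem norm_sum_star_mul_le_of_bound {ι : Type*} [Fintype ι] (X : Matrix ι ι ℂ) (M : ℝ)
    (hX : ∀ v : ι → ℂ, ∑ u, ‖(X *ᵥ v) u‖ ^ 2 ≤ M ^ 2 * ∑ u, ‖v u‖ ^ 2) (b : ι → B) :
    ‖∑ u, star (∑ y, X u y • star (b y)) * ∑ y, X u y • star (b y)‖ ≤
      M ^ 2 * ‖∑ y, b y * star (b y)‖ := by
  classical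
  let _ := CStarAlgebra.spectralOrder B
  have _ := CStarAlgebra.spectralOrderedRing B
  have hpsd : (((M : ℂ) ^ 2) • (1 : Matrix ι ι ℂ) - Xᴴ * X).PosSemidef := by
    refine Matrix.PosSemidef.of_dotProduct_mulVec_nonneg ?_ fun v => ?_
    · refine Matrix.IsHermitian.sub ?_ (Matrix.isHermitian_conjTranspose_mul_self X)
      simp [Matrix.IsHermitian, Matrix.conjTranspose_smul]
    · have e : ∀ w : ι → ℂ, star w ⬝ᵥ w = ((∑ u, ‖w u‖ ^ 2 : ℝ) : ℂ) := by
        intro w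
        simp only [dotProduct, Pi.star_apply, RCLike.star_def, Complex.conj_mul']
        push_cast
        rfl
      rw [Matrix.sub_mulVec, Matrix.smul_mulVec, Matrix.one_mulVec, dotProduct_sub,
        dotProduct_smul, ← Matrix.mulVec_mulVec, Matrix.dotProduct_mulVec,
        Matrix.vecMul_conjTranspose, star_star, e, e, smul_eq_mul, ← Complex.ofReal_pow,
        ← Complex.ofReal_mul, ← Complex.ofReal_sub, Complex.zero_le_real, sub_nonneg]
      exact hX v
  -- The bound on `X` says M² − XᴴX ≥ 0. Its factor `g` supplies the positive term that completes
  -- the sum for `X` to M² ∑ b b⋆.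
  obtain ⟨g, hg⟩ := CStarAlgebra.nonneg_iff_eq_star_mul_self.mp hpsd.nonneg
  rw [Matrix.star_eq_conjTranspose] at hg
  have key : ∀ Z : Matrix ι ι ℂ, ∑ u, star (∑ y, Z u y • star (b y)) * ∑ y, Z u y • star (b y) =
      ∑ y, ∑ y', (Zᴴ * Z) y y' • (b y * star (b y')) := by
    intro Z
    simp only [star_sum, star_smul, star_star, Finset.sum_mul_sum, smul_mul_smul_comm,
      Matrix.mul_apply, Finset.sum_smul, Matrix.conjTranspose_apply]
    rw [Finset.sum_comm]
    refine Finset.sum_congr rfl fun y _ => ?_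
    rw [Finset.sum_comm]
  have hnn : ∀ Z : Matrix ι ι ℂ,
      0 ≤ ∑ u, star (∑ y, Z u y • star (b y)) * ∑ y, Z u y • star (b y) := fun Z =>
    Finset.sum_nonneg fun u _ => star_mul_self_nonneg _
  have hsum : ∑ u, star (∑ y, X u y • star (b y)) * ∑ y, X u y • star (b y) +
      ∑ u, star (∑ y, g u y • star (b y)) * ∑ y, g u y • star (b y) =
      ((M : ℂ) ^ 2) • ∑ y, b y * star (b y) := by
    rw [key, key, ← hg, ← Finset.sum_add_distrib, Finset.smul_sum]
    refine Finset.sum_congr rfl fun y _ => ?_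
    rw [← Finset.sum_add_distrib]
    simp only [← add_smul, Matrix.sub_apply, add_sub_cancel, Matrix.smul_apply, Matrix.one_apply]
    rw [Finset.sum_eq_single y]
    · simp
    · intro y' _ h
      simp [Ne.symm h]
    · simp
  have hle := CStarAlgebra.norm_le_norm_of_nonneg_of_le (hnn X)
    (le_add_of_nonneg_right (hnn g))
  rw [hsum, norm_smul] at hle
  refine hle.trans (le_of_eq ?_)
  simp

/-- The sesquilinear expression `∑ Xᵤᵧ dᵤ bᵧ⋆` is bounded by the norms of the matrix and of the
two rows. -/
theorem norm_sum_sum_smul_sq_le {ι : Type*} [Fintype ι] (X : Matrix ι ι ℂ) (M : ℝ)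
    (hX : ∀ v : ι → ℂ, ∑ u, ‖(X.mulVec v) u‖ ^ 2 ≤ M ^ 2 * ∑ u, ‖v u‖ ^ 2) (d b : ι → B) :
    ‖∑ u, ∑ y, X u y • (d u * star (b y))‖ ^ 2 ≤
      M ^ 2 * (‖∑ u, d u * star (d u)‖ * ‖∑ y, b y * star (b y)‖) := by
  have h := norm_sum_mul_sq_le d fun u => ∑ y, X u y • star (b y)
  have e : ∑ u, ∑ y, X u y • (d u * star (b y)) = ∑ u, d u * ∑ y, X u y • star (b y) := by
    simp only [Finset.mul_sum, mul_smul_comm]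
  rw [e]
  calc _ ≤ _ := h
    _ ≤ ‖∑ u, d u * star (d u)‖ * (M ^ 2 * ‖∑ y, b y * star (b y)‖) :=
        mul_le_mul_of_nonneg_left (norm_sum_star_mul_le_of_bound X M hX b) (norm_nonneg _)
    _ = _ := by ring

end CStarCauchySchwarz

noncomputable section

namespace DirGraph

/-! ### Paths of E lifted to walks in E(n) -/

section PathCombinatorics

variable {E : DirGraph.{u}}

namespace Path

@[simp] theorem length_nil (x : E.Vert) : (nil x).length = 0 := rfl

@[simp] theorem range_nil (x : E.Vert) : (nil x).range = x := rfl

@[simp] theorem length_cons (e : E.Edge) (z : E.Path) (h : E.s e = z.range) :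
    (cons e z h).length = z.length + 1 := rfl

theorem cons_injective {e e' : E.Edge} {z z' : E.Path} {h : E.s e = z.range}
    {h' : E.s e' = z'.range} (H : cons e z h = cons e' z' h') : e = e' ∧ z = z' := by
  have h1 := congrArg Path.src H
  have h2 : e :: z.edges = e' :: z'.edges := congrArg Path.edges H
  rw [List.cons.injEq] at h2
  exact ⟨h2.1, Path.ext h1 h2.2⟩

@[elab_as_elim]
theorem induction_on {motive : E.Path → Prop} (z : E.Path) (nil : ∀ x, motive (nil x))
    (cons : ∀ e z h, motive z → motive (cons e z h)) : motive z := by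
  obtain ⟨x, l, hl⟩ := z
  induction l with
  | nil => exact nil x
  | cons e l ih => exact cons e ⟨x, l, hl.2⟩ hl.1 (ih hl.2)

theorem eq_nil_of_length_eq_zero {z : E.Path} (h : z.length = 0) : z = nil z.range := by
  induction z using induction_on with
  | nil x => rfl
  | cons e z h' => simp at h

theorem exists_eq_cons_of_length_ne_zero {z : E.Path} (h : z.length ≠ 0) :
    ∃ e z' h', z = cons e z' h' := by
  induction z using induction_on with
  | nil x => simp at h
  | cons e z h' => exact ⟨e, z, h', rfl⟩

theorem length_rem (n : ℕ) (z : E.Path) : (z.rem n).length = z.length % n := by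
  change (z.edges.take (z.length % n)).length = _
  rw [List.length_take, min_eq_left]
  exact Nat.mod_le _ _

theorem rem_eq_self {n : ℕ} {z : E.Path} (h : z.length < n) : z.rem n = z := by
  have h1 : z.length % n = z.length := Nat.mod_eq_of_lt h
  apply Path.ext
  · change walkRange z.src (z.edges.drop (z.length % n)) = z.src
    rw [h1, show z.edges.drop z.length = [] from List.drop_length]
    rfl
  · change z.edges.take (z.length % n) = z.edges
    rw [h1]
    exact List.take_length

theorem rem_cons_of_lt {n : ℕ} {e : E.Edge} {z : E.Path} (h : E.s e = z.range)
    (hn : z.length % n + 1 < n) :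
    (cons e z h).rem n = cons e (z.rem n) (h.trans (z.range_rem n).symm) := by
  have h1 : (z.length + 1) % n = z.length % n + 1 := by
    rw [Nat.add_mod, Nat.mod_eq_of_lt (show 1 < n by omega), Nat.mod_eq_of_lt hn]
  apply Path.ext
  · change walkRange z.src ((e :: z.edges).drop ((z.length + 1) % n)) =
      walkRange z.src (z.edges.drop (z.length % n))
    rw [h1, List.drop_succ_cons]
  · change (e :: z.edges).take ((z.length + 1) % n) = e :: z.edges.take (z.length % n)
    rw [h1, List.take_succ_cons]

theorem rem_cons_of_eq {n : ℕ} {e : E.Edge} {z : E.Path} (h : E.s e = z.range)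
    (hn : z.length % n + 1 = n) : (cons e z h).rem n = nil (E.r e) := by
  have h1 : (z.length + 1) % n = 0 := by
    rw [← Nat.mod_add_mod, hn, Nat.mod_self]
  apply Path.ext
  · change walkRange z.src ((e :: z.edges).drop ((z.length + 1) % n)) = E.r e
    rw [h1]
    rfl
  · change (e :: z.edges).take ((z.length + 1) % n) = []
    rw [h1]
    rfl

variable (n : ℕ) [NeZero n]

/-- The remainder `w(n)` as a vertex of `E(n)`. -/
def remVert (z : E.Path) : (E.periodGraph n).Vert :=
  ⟨z.rem n, by rw [length_rem]; exact Nat.mod_lt _ (NeZero.pos n)⟩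

/-- The edge `(e, w(n))` of `E(n)` along which `w` is extended to `ew`. -/
def remEdge (e : E.Edge) (z : E.Path) (h : E.s e = z.range) : (E.periodGraph n).Edge :=
  ⟨(e, z.remVert n), h.trans (z.range_rem n).symm⟩

@[simp] theorem s_remEdge (e : E.Edge) (z : E.Path) (h : E.s e = z.range) :
    (E.periodGraph n).s (remEdge n e z h) = z.remVert n := rfl

theorem remVert_val (z : E.Path) : (z.remVert n).1 = z.rem n := rfl

theorem remVert_of_lt {z : E.Path} (h : z.length < n) : z.remVert n = ⟨z, h⟩ :=
  Subtype.ext (rem_eq_self h)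

theorem remVert_coe (x : (E.periodGraph n).Vert) : x.1.remVert n = x :=
  Subtype.ext (rem_eq_self x.2)

-- The range map of E(n) is made for this: extending w by e moves the remainder along (e, w(n)), and
-- a completed period resets it to a vertex. So each path of E lifts to a walk in E(n) that begins
-- at a vertex of length zero.
@[simp] theorem r_remEdge (e : E.Edge) (z : E.Path) (h : E.s e = z.range) :
    (E.periodGraph n).r (remEdge n e z h) = (cons e z h).remVert n := by
  have hlt : z.length % n < n := Nat.mod_lt _ (NeZero.pos n)
  simp only [periodGraph, remEdge]
  split_ifs with h1 <;> rw [remVert_val, length_rem] at h1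
  · exact Subtype.ext (rem_cons_of_lt h h1).symm
  · exact Subtype.ext (rem_cons_of_eq h (by omega)).symm

theorem remEdge_eq_iff {e : E.Edge} {z : E.Path} {h : E.s e = z.range}
    {p : (E.periodGraph n).Edge} :
    remEdge n e z h = p ↔ e = p.1.1 ∧ z.remVert n = (E.periodGraph n).s p := by
  constructor
  · rintro rfl
    exact ⟨rfl, rfl⟩
  · rintro ⟨h1, h2⟩
    exact Subtype.ext (Prod.ext h1 h2)

theorem s_eq_range_of_remVert_eq {p : (E.periodGraph n).Edge} {z : E.Path}
    (h : z.remVert n = (E.periodGraph n).s p) : E.s p.1.1 = z.range := by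
  have h1 := p.2
  rw [← z.range_rem n, h1]
  exact congrArg (fun x => Path.range x.1) h.symm

end Path

open DirGraph.Path

/-- A partial bijection given by a partial map which is injective on its domain. -/
def _root_.PEquiv.ofPartialInj {α β : Type*} (f : α → Option β)
    (hf : ∀ a a' b, f a = some b → f a' = some b → a = a') : α ≃. β where
  toFun := f
  invFun b := open Classical in if h : ∃ a, f a = some b then some h.choose else none
  inv a b := by
    constructor
    · intro h
      split_ifs at h with h1
      · rw [← Option.some.inj h]
        exact h1.choose_spec
    · intro h
      have h1 : ∃ a, f a = some b := ⟨a, h⟩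
      rw [dif_pos h1]
      exact congrArg some (hf _ _ _ h1.choose_spec h)

variable (n : ℕ) [NeZero n]

open Classical in
/-- The partial bijection `w ↦ ew` of `E*` defined for those `w` whose remainder is the source of
the edge `p = (e, w(n))` of `E(n)`. -/
def shiftPEquiv (p : (E.periodGraph n).Edge) : E.Path ≃. E.Path :=
  PEquiv.ofPartialInj
    (fun z => if h : z.remVert n = (E.periodGraph n).s p then
      some (cons p.1.1 z (s_eq_range_of_remVert_eq n h)) else none)
    (by
      intro a a' b h h'
      split_ifs at h h'
      rw [← h'] at h
      exact (cons_injective (Option.some.inj h)).2)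

theorem shiftPEquiv_eq_some_iff {p : (E.periodGraph n).Edge} {z u : E.Path} :
    shiftPEquiv n p z = some u ↔ ∃ h : E.s p.1.1 = z.range, u = cons p.1.1 z h ∧
      z.remVert n = (E.periodGraph n).s p := by
  classical
  change dite _ _ _ = _ ↔ _
  constructor
  · intro h
    split_ifs at h with h1
    exact ⟨s_eq_range_of_remVert_eq n h1, (Option.some.inj h).symm, h1⟩
  · rintro ⟨h, rfl, h1⟩
    rw [dif_pos h1]

theorem shiftPEquiv_remEdge {e : E.Edge} {z : E.Path} (h : E.s e = z.range) :
    shiftPEquiv n (remEdge n e z h) z = some (cons e z h) :=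
  (shiftPEquiv_eq_some_iff n).2 ⟨h, rfl, rfl⟩

theorem shiftPEquiv_of_ne {p : (E.periodGraph n).Edge} {z : E.Path}
    (h : z.remVert n ≠ (E.periodGraph n).s p) : shiftPEquiv n p z = none := by
  rw [Option.eq_none_iff_forall_not_mem]
  intro u hu
  obtain ⟨_, _, h1⟩ := (shiftPEquiv_eq_some_iff n).1 hu
  exact h h1

/-- A path of positive length has exactly one predecessor and exactly one lifted last edge. The
shifts of distinct edges therefore have disjoint ranges. -/
theorem shiftPEquiv_eq_some_cons_iff {p : (E.periodGraph n).Edge} {z z' : E.Path} {e : E.Edge}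
    {h : E.s e = z.range} :
    shiftPEquiv n p z' = some (cons e z h) ↔ z' = z ∧ p = remEdge n e z h := by
  rw [shiftPEquiv_eq_some_iff]
  constructor
  · rintro ⟨h', h1, h2⟩
    obtain ⟨rfl, rfl⟩ := cons_injective h1
    exact ⟨rfl, ((remEdge_eq_iff n).2 ⟨rfl, h2⟩).symm⟩
  · rintro ⟨rfl, rfl⟩
    exact ⟨h, rfl, rfl⟩

theorem length_of_shiftPEquiv {p : (E.periodGraph n).Edge} {z u : E.Path}
    (h : shiftPEquiv n p z = some u) : u.length = z.length + 1 := by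
  obtain ⟨_, rfl, _⟩ := (shiftPEquiv_eq_some_iff n).1 h
  rfl

theorem remVert_of_shiftPEquiv {p : (E.periodGraph n).Edge} {z u : E.Path}
    (h : shiftPEquiv n p z = some u) :
    z.remVert n = (E.periodGraph n).s p ∧ u.remVert n = (E.periodGraph n).r p := by
  obtain ⟨h1, rfl, h2⟩ := (shiftPEquiv_eq_some_iff n).1 h
  refine ⟨h2, ?_⟩
  rw [← r_remEdge, (remEdge_eq_iff n).2 ⟨rfl, h2⟩]

theorem shiftPEquiv_symm_nil (p : (E.periodGraph n).Edge) (x : E.Vert) :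
    (shiftPEquiv n p).symm (nil x) = none := by
  rcases hz : (shiftPEquiv n p).symm (nil x) with _ | z'
  · rfl
  · simpa using length_of_shiftPEquiv n ((PEquiv.eq_some_iff _).1 hz)

instance finite_periodGraph_vert [Finite E.Vert] [Finite E.Edge] :
    Finite (E.periodGraph n).Vert :=
  inferInstanceAs (Finite {w : E.Path // w.length < n})

instance finite_periodGraph_edge [Finite E.Vert] [Finite E.Edge] :
    Finite (E.periodGraph n).Edge :=
  inferInstanceAs (Finite {p : E.Edge × {w : E.Path // w.length < n} // E.s p.1 = p.2.1.range})

instance [Finite E.Vert] [Finite E.Edge] : Fintype (E.periodGraph n).Vert := Fintype.ofFinite _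

instance [Finite E.Vert] [Finite E.Edge] : Fintype (E.periodGraph n).Edge := Fintype.ofFinite _

variable [Finite E.Vert] [Finite E.Edge]

theorem finite_setOf_length_lt (K : ℕ) : {z : E.Path | z.length < K}.Finite :=
  Set.finite_coe_iff.1 (finite_path_lt E K)

variable (E) in
/-- The finite set of paths of length `k`. -/
def pathsOfLength (k : ℕ) : Finset E.Path :=
  Set.Finite.toFinset (s := {z : E.Path | z.length = k}) <|
    (finite_setOf_length_lt (k + 1)).subset fun z hz => by
      simp only [Set.mem_ofPred_eq] at hz ⊢
      omega

variable (E) in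
/-- The finite set of paths of length less than `K`. -/
def pathsBelow (K : ℕ) : Finset E.Path :=
  (finite_setOf_length_lt (E := E) K).toFinset

@[simp] theorem mem_pathsOfLength {k : ℕ} {z : E.Path} : z ∈ E.pathsOfLength k ↔ z.length = k := by
  rw [pathsOfLength, Set.Finite.mem_toFinset, Set.mem_ofPred_eq]

@[simp] theorem mem_pathsBelow {K : ℕ} {z : E.Path} : z ∈ E.pathsBelow K ↔ z.length < K := by
  rw [pathsBelow, Set.Finite.mem_toFinset, Set.mem_ofPred_eq]

theorem sum_pathsBelow {M : Type*} [AddCommMonoid M] (K : ℕ) (g : E.Path → M) :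
    ∑ z ∈ E.pathsBelow K, g z = ∑ k ∈ Finset.range K, ∑ z ∈ E.pathsOfLength k, g z := by
  rw [← Finset.sum_fiberwise_of_maps_to (t := Finset.range K) (g := Path.length)]
  · refine Finset.sum_congr rfl fun k hk => Finset.sum_congr ?_ fun _ _ => rfl
    ext z
    simp only [Finset.mem_filter, mem_pathsBelow, mem_pathsOfLength, and_iff_right_iff_imp]
    rintro rfl
    simpa using hk
  · intro z hz
    simpa using hz

/-- Each path of length k + 1 is reached from exactly one pair (p, z); pairs outside the domain of
the shift contribute 0. -/
theorem sum_pathsOfLength_succ {M : Type*} [AddCommMonoid M] (k : ℕ) (g : E.Path → M) :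
    ∑ u ∈ E.pathsOfLength (k + 1), g u =
      ∑ p : (E.periodGraph n).Edge, ∑ z ∈ E.pathsOfLength k, (shiftPEquiv n p z).elim 0 g := by
  classical
  have h1 : ∀ (p : (E.periodGraph n).Edge), ∀ z ∈ E.pathsOfLength k,
      (shiftPEquiv n p z).elim 0 g =
        ∑ u ∈ E.pathsOfLength (k + 1), if shiftPEquiv n p z = some u then g u else 0 := by
    intro p z hz
    rcases hu : shiftPEquiv n p z with _ | u
    · simp
    · have hlen := length_of_shiftPEquiv n hu
      rw [mem_pathsOfLength] at hz
      rw [Finset.sum_eq_single u]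
      · simp
      · intro u' _ h'
        rw [if_neg]
        simpa using h'.symm
      · intro h
        simp only [mem_pathsOfLength] at h
        omega
  rw [Finset.sum_congr rfl fun p _ => Finset.sum_congr rfl (h1 p)]
  simp_rw [Finset.sum_comm (s := E.pathsOfLength k)]
  rw [Finset.sum_comm]
  refine Finset.sum_congr rfl fun u hu => ?_
  rw [mem_pathsOfLength] at hu
  obtain ⟨e, z, h, rfl⟩ := exists_eq_cons_of_length_ne_zero (z := u) (by omega)
  rw [length_cons] at hu
  simp_rw [shiftPEquiv_eq_some_cons_iff]
  rw [Finset.sum_eq_single (remEdge n e z h), Finset.sum_eq_single z]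
  · simp
  · intro z' _ h'
    simp [h']
  · intro h'
    simp only [mem_pathsOfLength] at h'
    omega
  · intro p _ hp
    simp [hp]
  · simp

theorem sum_pathsOfLength_of_lt {M : Type*} [AddCommMonoid M] {k : ℕ} (hk : k < n)
    (g : E.Path → M) : ∑ z ∈ E.pathsOfLength k, g z =
      ∑ x : (E.periodGraph n).Vert with x.1.length = k, g x.1 := by
  refine (Finset.sum_bij (fun x _ => x.1) ?_ ?_ ?_ ?_).symm
  · intro x hx
    simpa using hx
  · intro x _ y _ h
    exact Subtype.ext h
  · intro z hz
    rw [mem_pathsOfLength] at hz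
    exact ⟨⟨z, hz ▸ hk⟩, Finset.mem_filter.2 ⟨Finset.mem_univ _, hz⟩, rfl⟩
  · intros
    rfl

end PathCombinatorics

/-! ### Toeplitz families for E(n) and their words -/

section Toeplitz

open DirGraph.Path

variable {E : DirGraph.{u}} [Finite E.Vert] [Finite E.Edge] {n : ℕ} [NeZero n]
  {B : Type w} [NonUnitalCStarAlgebra B]

/-- A Toeplitz family for the graph `E(n)` whose defect projections `Q` live at the vertices of
length zero. -/
structure IsToeplitzFamily (V : (E.periodGraph n).Edge → B) (R Q : (E.periodGraph n).Vert → B) :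
    Prop where
  isProj : ∀ x, IsStarProjection (R x)
  orthogonal : ∀ x y, x ≠ y → R x * R y = 0
  isProj_defect : ∀ x, IsStarProjection (Q x)
  defect_mul : ∀ x, Q x * R x = Q x
  defect_eq_zero : ∀ x, x.1.length ≠ 0 → Q x = 0
  star_edge_mul : ∀ p q, p ≠ q → star (V p) * V q = 0
  star_edge_mul_self : ∀ p, star (V p) * V p = R ((E.periodGraph n).s p)
  sum_mul_star : ∀ x, open Classical in
    ∑ p with (E.periodGraph n).r p = x, V p * star (V p) = R x - Q x

/-- The element `V_{pₖ} ⋯ V_{p₁} X`, where `p₁, …, pₖ` are the edges of `E(n)` along which the path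
is built starting from its source. -/
def wordAux (V : (E.periodGraph n).Edge → B) (X : (E.periodGraph n).Vert → B) (x : E.Vert) :
    (l : List E.Edge) → IsWalk x l → B
  | [], _ => X ((Path.nil x).remVert n)
  | e :: l, h => V (Path.remEdge n e ⟨x, l, h.2⟩ h.1) * wordAux V X x l h.2

/-- The element `V_{pₖ} ⋯ V_{p₁} X` attached to a path of `E`. -/
def word (V : (E.periodGraph n).Edge → B) (X : (E.periodGraph n).Vert → B) (z : E.Path) : B :=
  wordAux V X z.src z.edges z.isWalk

omit [Finite E.Vert] [Finite E.Edge] in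
theorem word_nil (V : (E.periodGraph n).Edge → B) (X : (E.periodGraph n).Vert → B) (x : E.Vert) :
    word V X (nil x) = X ((nil x).remVert n) := rfl

omit [Finite E.Vert] [Finite E.Edge] in
theorem word_cons (V : (E.periodGraph n).Edge → B) (X : (E.periodGraph n).Vert → B) (e : E.Edge)
    (z : E.Path) (h : E.s e = z.range) :
    word V X (cons e z h) = V (remEdge n e z h) * word V X z := rfl

namespace IsToeplitzFamily

variable {V : (E.periodGraph n).Edge → B} {R Q : (E.periodGraph n).Vert → B}
  (hT : IsToeplitzFamily V R Q)

include hT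

/-- (V − VR)⋆(V − VR) expands to R − R − R + R = 0, and the C⋆-identity concludes. -/
theorem mul_proj_source (p : (E.periodGraph n).Edge) : V p * R ((E.periodGraph n).s p) = V p := by
  have h := (hT.isProj ((E.periodGraph n).s p)).isIdempotentElem.eq
  have h' := (hT.isProj ((E.periodGraph n).s p)).isSelfAdjoint.star_eq
  rw [← sub_eq_zero, ← CStarRing.star_mul_self_eq_zero_iff]
  simp only [star_sub, star_mul, sub_mul, mul_sub, h', mul_assoc, hT.star_edge_mul_self, h]
  simp only [← mul_assoc, hT.star_edge_mul_self, h]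
  simp

theorem mul_proj_of_ne {p : (E.periodGraph n).Edge} {x : (E.periodGraph n).Vert}
    (h : x ≠ (E.periodGraph n).s p) : V p * R x = 0 := by
  rw [← hT.mul_proj_source, mul_assoc, hT.orthogonal _ _ h.symm, mul_zero]

theorem sub_mul_edge (p : (E.periodGraph n).Edge) :
    (R ((E.periodGraph n).r p) - Q ((E.periodGraph n).r p)) * V p = V p := by
  classical
  rw [← hT.sum_mul_star, Finset.sum_mul, Finset.sum_eq_single p]
  · rw [mul_assoc, hT.star_edge_mul_self, hT.mul_proj_source]
  · intro q _ hq
    rw [mul_assoc, hT.star_edge_mul _ _ hq, mul_zero]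
  · intro h
    simp at h

theorem defect_mul_sub_self (x : (E.periodGraph n).Vert) : Q x * (R x - Q x) = 0 := by
  rw [mul_sub, hT.defect_mul, (hT.isProj_defect x).isIdempotentElem.eq, sub_self]

theorem proj_mul_defect (x : (E.periodGraph n).Vert) : R x * Q x = Q x := by
  have h := congrArg star (hT.defect_mul x)
  rwa [star_mul, (hT.isProj x).isSelfAdjoint.star_eq,
    (hT.isProj_defect x).isSelfAdjoint.star_eq] at h

theorem defect_mul_sub (x y : (E.periodGraph n).Vert) : Q x * (R y - Q y) = 0 := by
  by_cases hxy : x = y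
  · rw [hxy, hT.defect_mul_sub_self]
  · rw [← hT.defect_mul x, ← hT.proj_mul_defect y]
    simp only [mul_sub, mul_assoc, hT.orthogonal x y hxy, mul_zero]
    simp only [← mul_assoc]
    rw [mul_assoc (Q x), hT.orthogonal x y hxy]
    simp

/-- The range of V_p lies under R − Q, which is orthogonal to Q. -/
theorem defect_range_mul (p : (E.periodGraph n).Edge) : Q ((E.periodGraph n).r p) * V p = 0 := by
  rw [← hT.sub_mul_edge p, ← mul_assoc, hT.defect_mul_sub, zero_mul]

theorem proj_range_mul (p : (E.periodGraph n).Edge) : R ((E.periodGraph n).r p) * V p = V p := by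
  have h := hT.sub_mul_edge p
  rwa [sub_mul, hT.defect_range_mul, sub_zero] at h

theorem defect_mul_edge (x : (E.periodGraph n).Vert) (p : (E.periodGraph n).Edge) :
    Q x * V p = 0 := by
  by_cases h : x = (E.periodGraph n).r p
  · rw [h, hT.defect_range_mul]
  · rw [← hT.proj_range_mul, ← hT.defect_mul, mul_assoc, ← mul_assoc (R x),
      hT.orthogonal _ _ h, zero_mul, mul_zero]

theorem star_edge_mul_defect (x : (E.periodGraph n).Vert) (p : (E.periodGraph n).Edge) :
    star (V p) * Q x = 0 := by
  have h := congrArg star (hT.defect_mul_edge x p)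
  rwa [star_mul, (hT.isProj_defect x).isSelfAdjoint.star_eq, star_zero] at h

theorem isProj_sub (x : (E.periodGraph n).Vert) : IsStarProjection ((R - Q) x) := by
  refine ⟨?_, (hT.isProj x).isSelfAdjoint.sub (hT.isProj_defect x).isSelfAdjoint⟩
  change (R x - Q x) * (R x - Q x) = R x - Q x
  rw [sub_mul, hT.defect_mul_sub_self, mul_sub, (hT.isProj x).isIdempotentElem.eq,
    hT.proj_mul_defect, sub_zero]

theorem proj_mul_sub (x : (E.periodGraph n).Vert) : R x * (R - Q) x = (R - Q) x := by
  rw [Pi.sub_apply, mul_sub, (hT.isProj x).isIdempotentElem.eq, hT.proj_mul_defect]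

section Word

variable {X : (E.periodGraph n).Vert → B} (hX : ∀ x, R x * X x = X x)

include hX

theorem proj_mul_word (z : E.Path) : R (z.remVert n) * word V X z = word V X z := by
  induction z using Path.induction_on with
  | nil x => rw [word_nil, hX]
  | cons e z h _ => rw [word_cons, ← r_remEdge n, ← mul_assoc, hT.proj_range_mul]

theorem edge_mul_word (p : (E.periodGraph n).Edge) (z : E.Path) :
    V p * word V X z = (shiftPEquiv n p z).elim 0 (word V X) := by
  by_cases h : z.remVert n = (E.periodGraph n).s p
  · obtain ⟨e, he, rfl⟩ : ∃ e, ∃ h : E.s e = z.range, remEdge n e z h = p :=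
      ⟨p.1.1, s_eq_range_of_remVert_eq n h, (remEdge_eq_iff n).2 ⟨rfl, h⟩⟩
    rw [shiftPEquiv_remEdge, Option.elim_some, word_cons]
  · rw [shiftPEquiv_of_ne n h, Option.elim_none, ← hT.proj_mul_word hX, ← mul_assoc,
      hT.mul_proj_of_ne h, zero_mul]

/-- With `edge_mul_word`, this makes words behave like basis vectors under the shift and its
adjoint. Length zero is left out: there V_p⋆ kills the words ending in Q, by `star_edge_mul_defect`,
but not necessarily those ending in R − Q. -/
theorem star_edge_mul_word_cons (p : (E.periodGraph n).Edge) (e : E.Edge) (z : E.Path)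
    (h : E.s e = z.range) : star (V p) * word V X (cons e z h) =
      ((shiftPEquiv n p).symm (cons e z h)).elim 0 (word V X) := by
  rw [word_cons, ← mul_assoc]
  by_cases hp : p = remEdge n e z h
  · rw [(PEquiv.eq_some_iff _).2 ((shiftPEquiv_eq_some_cons_iff n).2 ⟨rfl, hp⟩), hp,
      hT.star_edge_mul_self, s_remEdge, hT.proj_mul_word hX, Option.elim_some]
  · rw [hT.star_edge_mul _ _ hp, zero_mul]
    rcases hz : (shiftPEquiv n p).symm (cons e z h) with _ | z'
    · rfl
    · exact absurd ((shiftPEquiv_eq_some_cons_iff n).1 ((PEquiv.eq_some_iff _).1 hz)).2 hp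

end Word

end IsToeplitzFamily

end Toeplitz

/-! ### Range projections of words, level by level -/

section Levels

open DirGraph.Path

variable {E : DirGraph.{u}} [Finite E.Vert] [Finite E.Edge] {n : ℕ} [NeZero n]
  {B : Type w} [NonUnitalCStarAlgebra B]

/-- The completely positive map `X ↦ ∑ₚ Vₚ X Vₚ⋆`. -/
def edgeSum (V : (E.periodGraph n).Edge → B) : B →+ B where
  toFun X := ∑ p, V p * X * star (V p)
  map_zero' := by simp
  map_add' X Y := by simp [mul_add, add_mul, Finset.sum_add_distrib]

/-- The sum of the range projections of the words of length `k`. -/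
def levelSum (V : (E.periodGraph n).Edge → B) (X : (E.periodGraph n).Vert → B) (k : ℕ) : B :=
  ∑ z ∈ E.pathsOfLength k, word V X z * star (word V X z)

/-- The sum of the projections at the vertices of length `k`. -/
def vertSum (X : (E.periodGraph n).Vert → B) (k : ℕ) : B :=
  ∑ x : (E.periodGraph n).Vert with x.1.length = k, X x

omit [Finite E.Vert] [Finite E.Edge] in
theorem length_r_periodGraph (p : (E.periodGraph n).Edge) :
    ((E.periodGraph n).r p).1.length = (((E.periodGraph n).s p).1.length + 1) % n := by
  have h := ((E.periodGraph n).s p).2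
  change ((E.periodGraph n).s p).1.length < n at h
  simp only [periodGraph] at h ⊢
  split_ifs with h1
  · rw [Nat.mod_eq_of_lt h1]
    rfl
  · rw [show p.1.2.1.length + 1 = n by omega, Nat.mod_self]
    rfl

namespace IsToeplitzFamily

variable {V : (E.periodGraph n).Edge → B} {R Q : (E.periodGraph n).Vert → B}
  (hT : IsToeplitzFamily V R Q)

include hT

theorem edgeSum_levelSum {X : (E.periodGraph n).Vert → B} (hX : ∀ x, R x * X x = X x) (k : ℕ) :
    edgeSum V (levelSum V X k) = levelSum V X (k + 1) := by
  rw [levelSum.eq_def V X (k + 1), sum_pathsOfLength_succ n]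
  change ∑ p, _ = _
  refine Finset.sum_congr rfl fun p _ => ?_
  rw [levelSum, Finset.mul_sum, Finset.sum_mul]
  refine Finset.sum_congr rfl fun z _ => ?_
  rw [← mul_assoc, mul_assoc, ← star_mul, hT.edge_mul_word hX]
  cases shiftPEquiv n p z <;> simp

/-- Only the edges that start at level k survive. They are exactly the edges that end at level (k +
1) mod n, so the Toeplitz relation sums them to R − Q on that level. -/
theorem edgeSum_vertSum {k : ℕ} (hk : k < n) :
    edgeSum V (vertSum R k) = vertSum (R - Q) ((k + 1) % n) := by
  classical
  have h1 : ∀ p, V p * vertSum R k * star (V p) =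
      if ((E.periodGraph n).s p).1.length = k then V p * star (V p) else 0 := by
    intro p
    rw [vertSum, Finset.mul_sum]
    split_ifs with h
    · rw [Finset.sum_eq_single ((E.periodGraph n).s p), hT.mul_proj_source]
      · intro x _ hx
        exact hT.mul_proj_of_ne hx
      · intro h'
        simp [h] at h'
    · rw [Finset.sum_eq_zero, zero_mul]
      intro x hx
      refine hT.mul_proj_of_ne ?_
      rintro rfl
      exact h (Finset.mem_filter.1 hx).2
  change ∑ p, _ = _
  rw [Finset.sum_congr rfl fun p _ => h1 p, ← Finset.sum_filter, vertSum]
  simp only [Pi.sub_apply, ← hT.sum_mul_star]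
  rw [← Finset.sum_fiberwise_of_maps_to (g := (E.periodGraph n).r)
    (t := {x : (E.periodGraph n).Vert | x.1.length = (k + 1) % n})]
  · refine Finset.sum_congr rfl fun x hx => Finset.sum_congr ?_ fun _ _ => rfl
    ext p
    simp only [Finset.mem_filter, Finset.mem_univ, true_and, and_iff_right_iff_imp] at hx ⊢
    rintro rfl
    rw [length_r_periodGraph] at hx
    have hlt : ((E.periodGraph n).s p).1.length < n := ((E.periodGraph n).s p).2
    -- Adding one modulo n is injective on lengths below n, so the length of the range determines
    -- that of the source.
    by_cases h2 : k + 1 < n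
    · rw [Nat.mod_eq_of_lt h2] at hx
      by_cases h3 : ((E.periodGraph n).s p).1.length + 1 < n
      · rw [Nat.mod_eq_of_lt h3] at hx
        omega
      · rw [show ((E.periodGraph n).s p).1.length + 1 = n by omega, Nat.mod_self] at hx
        omega
    · rw [show k + 1 = n by omega, Nat.mod_self] at hx
      by_cases h3 : ((E.periodGraph n).s p).1.length + 1 < n
      · rw [Nat.mod_eq_of_lt h3] at hx
        omega
      · omega
  · intro p hp
    simp only [Finset.mem_filter, Finset.mem_univ, true_and] at hp ⊢
    rw [length_r_periodGraph, hp]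

theorem vertSum_sub {k : ℕ} (hk : k ≠ 0) : vertSum (R - Q) k = vertSum R k := by
  refine Finset.sum_congr rfl fun x hx => ?_
  simp only [Finset.mem_filter, Finset.mem_univ, true_and] at hx
  rw [Pi.sub_apply, hT.defect_eq_zero x (by omega), sub_zero]

omit hT in
theorem _root_.DirGraph.levelSum_zero {X : (E.periodGraph n).Vert → B}
    (hX : ∀ x, IsStarProjection (X x)) : levelSum V X 0 = vertSum X 0 := by
  rw [levelSum, sum_pathsOfLength_of_lt n (NeZero.pos n)]
  refine Finset.sum_congr rfl fun x hx => ?_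
  simp only [Finset.mem_filter, Finset.mem_univ, true_and] at hx
  have h : word V X x.1 = X x := by
    rw [eq_nil_of_length_eq_zero hx, word_nil, ← eq_nil_of_length_eq_zero hx, remVert_coe]
  rw [h, (hX x).isSelfAdjoint.star_eq, (hX x).isIdempotentElem.eq]

theorem levelSum_add_zero : levelSum V Q 0 + levelSum V (R - Q) 0 = vertSum R 0 := by
  rw [levelSum_zero hT.isProj_defect, levelSum_zero hT.isProj_sub, vertSum, vertSum, vertSum,
    ← Finset.sum_add_distrib]
  simp

/-- Before a period is completed nothing is lost, because the defects vanish at all levels from 1 to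
n − 1. -/
theorem levelSum_add_of_lt {k : ℕ} (hk : k < n) :
    levelSum V Q k + levelSum V (R - Q) k = vertSum R k := by
  induction k with
  | zero => exact hT.levelSum_add_zero
  | succ k ih =>
    rw [← hT.edgeSum_levelSum hT.proj_mul_defect, ← hT.edgeSum_levelSum hT.proj_mul_sub, ← map_add,
      ih (by omega), hT.edgeSum_vertSum (by omega), Nat.mod_eq_of_lt hk,
      hT.vertSum_sub k.succ_ne_zero]

/-- Wrapping from level n − 1 to level 0 produces R − Q instead of R. Further applications of
`edgeSum` carry this relation to every k. -/
theorem levelSum_add_add (k : ℕ) :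
    levelSum V Q (n + k) + levelSum V (R - Q) (n + k) = levelSum V (R - Q) k := by
  induction k with
  | zero =>
    have hn : 0 < n := NeZero.pos n
    rw [levelSum_zero hT.isProj_sub, add_zero]
    have h := congrArg (edgeSum V) (hT.levelSum_add_of_lt (k := n - 1) (by omega))
    rwa [map_add, hT.edgeSum_levelSum hT.proj_mul_defect, hT.edgeSum_levelSum hT.proj_mul_sub,
      hT.edgeSum_vertSum (by omega), Nat.sub_add_cancel (by omega), Nat.mod_self] at h
  | succ k ih =>
    rw [← add_assoc, ← hT.edgeSum_levelSum hT.proj_mul_defect,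
      ← hT.edgeSum_levelSum hT.proj_mul_sub, ← map_add, ih, hT.edgeSum_levelSum hT.proj_mul_sub]

/-- By `levelSum_add_add`, each block of n levels of words ending in R − Q splits into the next
blocks of both kinds; iterating refines ∑ R_x. -/
theorem sum_levelSum_add (m : ℕ) :
    ∑ k ∈ Finset.range (n * (m + 1)), levelSum V Q k +
      ∑ i ∈ Finset.range n, levelSum V (R - Q) (n * m + i) = ∑ x, R x := by
  induction m with
  | zero =>
    rw [zero_add, mul_one, mul_zero, ← Finset.sum_add_distrib,
      ← Finset.sum_fiberwise_of_maps_to (t := Finset.range n)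
        (g := fun x : (E.periodGraph n).Vert => x.1.length)]
    · refine Finset.sum_congr rfl fun k hk => ?_
      rw [zero_add, hT.levelSum_add_of_lt (Finset.mem_range.1 hk), vertSum]
    · intro x _
      exact Finset.mem_range.2 x.2
  | succ m ih =>
    rw [mul_add n (m + 1) 1, mul_one, Finset.sum_range_add, add_assoc, ← Finset.sum_add_distrib,
      ← ih]
    congr 1
    refine Finset.sum_congr rfl fun i _ => ?_
    rw [← hT.levelSum_add_add (n * m + i), ← add_assoc n, show n + n * m = n * (m + 1) by ring]

theorem isProj_sum : IsStarProjection (∑ x, R x) := by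
  classical
  refine ⟨?_, ?_⟩
  · change _ * _ = _
    rw [Finset.sum_mul]
    refine Finset.sum_congr rfl fun x _ => ?_
    rw [Finset.mul_sum, Finset.sum_eq_single x, (hT.isProj x).isIdempotentElem.eq]
    · intro y _ h
      exact hT.orthogonal _ _ h.symm
    · simp
  · rw [isSelfAdjoint_iff, star_sum]
    exact Finset.sum_congr rfl fun x _ => (hT.isProj x).isSelfAdjoint.star_eq

/-- The Fejér-type weighted sum of the range projections of all words of length less than `n * N`
is the unit. -/
theorem sum_weighted_levelSum (N : ℕ) :
    ∑ k ∈ Finset.range (n * N), (((N : ℝ) - (k / n : ℕ)) • levelSum V Q k +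
      levelSum V (R - Q) k) = (N : ℝ) • ∑ x, R x := by
  induction N with
  | zero => simp
  | succ N ih =>
    -- Adding `sum_levelSum_add` for m = N raises every earlier Q-coefficient by one and creates a
    -- new block with coefficient (N + 1) − N = 1.
    rw [Nat.cast_succ, add_smul, one_smul, ← ih, ← hT.sum_levelSum_add N,
      mul_add n N 1, mul_one, Finset.sum_range_add, Finset.sum_range_add, ← add_assoc,
      ← add_assoc, ← Finset.sum_add_distrib, add_assoc, ← Finset.sum_add_distrib]
    congr 1
    · refine Finset.sum_congr rfl fun k _ => ?_
      module
    · refine Finset.sum_congr rfl fun i hi => ?_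
      have h1 : (n * N + i) / n = N := by
        rw [Nat.mul_add_div (NeZero.pos n), Nat.div_eq_of_lt (Finset.mem_range.1 hi), add_zero]
      rw [h1]
      module

omit hT in
theorem _root_.DirGraph.levelSum_nonneg [PartialOrder B] [StarOrderedRing B]
    (X : (E.periodGraph n).Vert → B) (k : ℕ) : 0 ≤ levelSum V X k :=
  Finset.sum_nonneg fun _ _ => mul_star_self_nonneg _

/-- All terms of `sum_levelSum_add` are positive, so partial sums lie below the projection ∑ R_x.
Taking m = K suffices since K ≤ n(K + 1). -/
theorem norm_sum_levelSum_defect_le (K : ℕ) :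
    ‖∑ k ∈ Finset.range K, levelSum V Q k‖ ≤ 1 := by
  let _ := CStarAlgebra.spectralOrder B
  have _ := CStarAlgebra.spectralOrderedRing B
  refine (CStarAlgebra.norm_le_norm_of_nonneg_of_le (Finset.sum_nonneg fun _ _ =>
    levelSum_nonneg _ _) ?_).trans hT.isProj_sum.norm_le
  rw [← hT.sum_levelSum_add K]
  refine le_add_of_le_of_nonneg ?_ (Finset.sum_nonneg fun _ _ => levelSum_nonneg _ _)
  refine Finset.sum_le_sum_of_subset_of_nonneg ?_ fun _ _ _ => levelSum_nonneg _ _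
  refine Finset.range_subset_range.2 ?_
  have : 1 ≤ n := NeZero.pos n
  nlinarith

theorem norm_levelSum_sub_le (k : ℕ) : ‖levelSum V (R - Q) k‖ ≤ 1 := by
  let _ := CStarAlgebra.spectralOrder B
  have _ := CStarAlgebra.spectralOrderedRing B
  refine (CStarAlgebra.norm_le_norm_of_nonneg_of_le (levelSum_nonneg _ _) ?_).trans
    hT.isProj_sum.norm_le
  rw [← hT.sum_levelSum_add (k / n)]
  refine le_add_of_nonneg_of_le (Finset.sum_nonneg fun _ _ => levelSum_nonneg _ _) ?_
  nth_rewrite 1 [← Nat.div_add_mod k n]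
  exact Finset.single_le_sum (f := fun i => levelSum V (R - Q) (n * (k / n) + i))
    (fun _ _ => levelSum_nonneg _ _) (Finset.mem_range.2 (Nat.mod_lt _ (NeZero.pos n)))

end IsToeplitzFamily

end Levels

/-! ### Operators on ℓ²(E*) given by partial bijections of the basis -/

section Fock

open DirGraph.Path

variable {E : DirGraph.{u}}

theorem inner_xi_left (z : E.Path) (η : E.FockSpace) :
    inner ℂ (xi z) η = (show lp (fun _ : E.Path => ℂ) 2 from η) z := by
  classical
  have h := lp.inner_single_left (𝕜 := ℂ) (G := fun _ : E.Path => ℂ) z (1 : ℂ) η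
  refine Eq.trans ?_ (h.trans ?_)
  · change inner ℂ (lp.single 2 z (1 : ℂ) : lp (fun _ : E.Path => ℂ) 2) η = _
    congr!
  · simp

theorem ext_inner_xi {η ζ : E.FockSpace} (h : ∀ z : E.Path, inner ℂ (xi z) η = inner ℂ (xi z) ζ) :
    η = ζ := by
  refine lp.ext (E := fun _ : E.Path => ℂ) (p := 2) (funext fun z => ?_)
  have h1 := h z
  rwa [inner_xi_left, inner_xi_left] at h1

open Classical in
theorem inner_xi_xi (z y : E.Path) : inner ℂ (xi z) (xi y) = if z = y then (1 : ℂ) else 0 := by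
  rw [inner_xi_left]
  change (lp.single 2 y (1 : ℂ) : lp (fun _ : E.Path => ℂ) 2) z = _
  rw [lp.coeFn_single, Pi.single_apply]

theorem orthonormal_xi : Orthonormal ℂ (xi : E.Path → E.FockSpace) := by
  classical
  rw [orthonormal_iff_ite]
  intro i j
  rw [inner_xi_xi]

/-- Operators on the Fock space are determined by their values on the standard basis. -/
theorem ext_xi {S T : E.FockSpace →L[ℂ] E.FockSpace} (h : ∀ z, S (xi z) = T (xi z)) : S = T := by
  classical
  ext1 η
  have h1 : HasSum (fun z : E.Path => inner ℂ (xi z) η • xi z) η := by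
    have h2 := lp.hasSum_single (E := fun _ : E.Path => ℂ) (p := 2) (by simp)
      (show lp (fun _ : E.Path => ℂ) 2 from η)
    refine Eq.mp ?_ h2
    change HasSum (α := E.FockSpace) _ _ = _
    congr 1
    funext z
    rw [inner_xi_left]
    have h3 := lp.single_smul (E := fun _ : E.Path => ℂ) 2 z
      ((show lp (fun _ : E.Path => ℂ) 2 from η) z) (1 : ℂ)
    rw [smul_eq_mul, mul_one] at h3
    exact h3
  have hS := h1.mapL S
  have hT := h1.mapL T
  simp only [map_smul, h] at hS hT
  exact hS.unique hT

/-- The coordinates of the image of `η` under the operator of a partial bijection. -/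
def pequivFun (f : E.Path ≃. E.Path) (η : E.Path → ℂ) (y : E.Path) : ℂ := (f.symm y).elim 0 η

theorem pequivFun_add (f : E.Path ≃. E.Path) (η ζ : E.Path → ℂ) :
    pequivFun f (η + ζ) = pequivFun f η + pequivFun f ζ := by
  funext y
  simp only [pequivFun, Pi.add_apply]
  cases f.symm y <;> simp

theorem pequivFun_smul (f : E.Path ≃. E.Path) (c : ℂ) (η : E.Path → ℂ) :
    pequivFun f (c • η) = c • pequivFun f η := by
  funext y
  simp only [pequivFun, Pi.smul_apply]
  cases f.symm y <;> simp

/-- Injectivity of the partial inverse ensures that each coordinate of `η` is counted at most once.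
-/
theorem sum_norm_pequivFun_le (f : E.Path ≃. E.Path) (η : lp (fun _ : E.Path => ℂ) 2)
    (s : Finset E.Path) :
    ∑ y ∈ s, ‖pequivFun f η y‖ ^ (2 : ℝ≥0∞).toReal ≤ ‖η‖ ^ (2 : ℝ≥0∞).toReal := by
  classical
  refine le_trans ?_ (lp.sum_rpow_le_norm_rpow (by simp) η (s.biUnion fun y => (f.symm y).toFinset))
  rw [Finset.sum_biUnion]
  · refine Finset.sum_le_sum fun y _ => ?_
    rw [pequivFun]
    cases f.symm y <;> simp
  · intro y _ y' _ hy
    simp only [Function.onFun]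
    rw [Finset.disjoint_left]
    intro z hz hz'
    rw [Option.mem_toFinset] at hz hz'
    exact hy (f.symm.inj hz hz')

/-- The partial isometry of the Fock space given by a partial bijection of its standard basis. -/
def pequivOp (f : E.Path ≃. E.Path) : E.FockSpace →L[ℂ] E.FockSpace :=
  LinearMap.mkContinuous (E := E.FockSpace) (F := E.FockSpace)
    { toFun := fun η =>
        (⟨pequivFun f (show lp (fun _ : E.Path => ℂ) 2 from η),
          memℓp_gen' (sum_norm_pequivFun_le f η)⟩ : lp (fun _ : E.Path => ℂ) 2)
      map_add' := fun η ζ => lp.ext (E := fun _ : E.Path => ℂ) (p := 2) (pequivFun_add f _ _)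
      map_smul' := fun c η => lp.ext (E := fun _ : E.Path => ℂ) (p := 2) (pequivFun_smul f c _) } 1
    fun η => by
      rw [one_mul]
      exact lp.norm_le_of_forall_sum_le (E := fun _ : E.Path => ℂ) (p := 2) (by simp)
        (norm_nonneg _) (sum_norm_pequivFun_le f η)

theorem inner_xi_pequivOp (f : E.Path ≃. E.Path) (y : E.Path) (η : E.FockSpace) :
    inner ℂ (xi y) (pequivOp f η) = (f.symm y).elim 0 fun z => inner ℂ (xi z) η := by
  rw [inner_xi_left]
  simp only [inner_xi_left]
  rfl

theorem pequivOp_xi (f : E.Path ≃. E.Path) (z : E.Path) :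
    pequivOp f (xi z) = (f z).elim 0 xi := by
  classical
  refine ext_inner_xi fun y => ?_
  rw [inner_xi_pequivOp]
  simp only [inner_xi_xi]
  rcases hz : f z with _ | u <;> rcases hy : f.symm y with _ | v
  · simp
  · have h := (PEquiv.eq_some_iff f).1 hy
    have : v ≠ z := by
      rintro rfl
      simp [hz] at h
    simp [this]
  · have : y ≠ u := by
      rintro rfl
      rw [← PEquiv.eq_some_iff, hy] at hz
      simp at hz
    simp [inner_xi_xi, this]
  · have h := (PEquiv.eq_some_iff f).1 hy
    simp only [Option.elim_some, inner_xi_xi]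
    congr 1
    rw [eq_iff_iff]
    constructor
    · rintro rfl
      rw [hz] at h
      exact (Option.some.inj h).symm
    · rintro rfl
      rw [← PEquiv.eq_some_iff, hy] at hz
      exact Option.some.inj hz

theorem star_pequivOp (f : E.Path ≃. E.Path) : star (pequivOp f) = pequivOp f.symm := by
  refine ext_xi fun u => ext_inner_xi fun z => ?_
  rw [ContinuousLinearMap.star_eq_adjoint, ContinuousLinearMap.adjoint_inner_right,
    inner_xi_pequivOp, PEquiv.symm_symm, pequivOp_xi]
  rcases f z with _ | w <;> simp

end Fock

/-! ### Compressing operators on ℓ²(E*) along two rows -/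

section RowForm

open DirGraph.Path

variable {E : DirGraph.{u}} {B : Type w} [NonUnitalCStarAlgebra B]

theorem sum_elim_pequiv {α M : Type*} [AddCommMonoid M] [DecidableEq α] (f : α ≃. α) (s : Finset α)
    (g : α → M) : ∑ z ∈ s, (f z).elim 0 g = ∑ u ∈ s.biUnion fun z => (f z).toFinset, g u := by
  rw [Finset.sum_biUnion]
  · refine Finset.sum_congr rfl fun y _ => ?_
    cases f y <;> simp
  · intro y _ y' _ hy
    simp only [Function.onFun]
    rw [Finset.disjoint_left]
    intro z hz hz'
    rw [Option.mem_toFinset] at hz hz'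
    exact hy (f.inj hz hz')

/-- Reindexing along `f`. The hypothesis ensures that truncation to `s` never separates a pair z ↦ u
that carries a nonzero term. -/
theorem sum_symm_elim_smul {α M : Type*} [AddCommGroup M] [Module ℂ M] (f : α ≃. α) (s : Finset α)
    (g : α → ℂ) (c : α → M) (h : ∀ z u, f z = some u → c u ≠ 0 → z ∈ s ∧ u ∈ s) :
    ∑ u ∈ s, (f.symm u).elim 0 g • c u = ∑ z ∈ s, g z • (f z).elim 0 c := by
  classical
  have h1 : ∀ u ∈ s, (f.symm u).elim 0 g • c u =
      ∑ z ∈ s, if f z = some u then g z • c u else 0 := by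
    intro u _
    rcases hz : f.symm u with _ | z
    · rw [Finset.sum_eq_zero]
      · simp
      · intro z _
        rw [if_neg]
        rw [← PEquiv.eq_some_iff, hz]
        simp
    · have hz' := (PEquiv.eq_some_iff f).1 hz
      by_cases hc : c u = 0
      · simp [hc]
      · rw [Finset.sum_eq_single z]
        · simp [hz']
        · intro y _ hy
          rw [if_neg]
          intro hy'
          exact hy (f.inj hy' hz')
        · intro hzs
          exact absurd (h z u hz' hc).1 hzs
  have h2 : ∀ z ∈ s, g z • (f z).elim 0 c = ∑ u ∈ s, if f z = some u then g z • c u else 0 := by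
    intro z _
    rcases hu : f z with _ | u
    · simp
    · by_cases hc : c u = 0
      · rw [Finset.sum_eq_zero]
        · simp [hc]
        · intro y _
          split_ifs with hy
          · rw [← Option.some.inj hy, hc, smul_zero]
          · rfl
      · rw [Finset.sum_eq_single u]
        · simp
        · intro y _ hy
          rw [if_neg]
          intro hy'
          exact hy (Option.some.inj hy').symm
        · intro hus
          exact absurd (h z u hu hc).2 hus
  rw [Finset.sum_congr rfl h1, Finset.sum_congr rfl h2, Finset.sum_comm]

/-- The compression `∑ ⟨ξᵤ, x ξᵧ⟩ dᵤ bᵧ⋆` of an operator on the Fock space along two rows. -/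
def rowForm (J : Finset E.Path) (d b : E.Path → B) (x : E.FockSpace →L[ℂ] E.FockSpace) : B :=
  ∑ u ∈ J, ∑ y ∈ J, inner ℂ (xi u) (x (xi y)) • (d u * star (b y))

/-- The matrix of `x` over `J` is a compression of `x`, so Bessel's inequality bounds it by ‖x‖ and
`norm_sum_sum_smul_sq_le` applies. -/
theorem norm_rowForm_sq_le (J : Finset E.Path) (d b : E.Path → B)
    (x : E.FockSpace →L[ℂ] E.FockSpace) :
    ‖rowForm J d b x‖ ^ 2 ≤
      ‖x‖ ^ 2 * (‖∑ u ∈ J, d u * star (d u)‖ * ‖∑ y ∈ J, b y * star (b y)‖) := by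
  have h := norm_sum_sum_smul_sq_le (B := B) (ι := J)
    (Matrix.of fun u y => inner ℂ (xi u.1) (x (xi y.1))) ‖x‖ ?_ (fun u => d u) (fun u => b u)
  · rw [Finset.sum_coe_sort J (fun u => d u * star (d u)),
      Finset.sum_coe_sort J (fun u => b u * star (b u))] at h
    refine le_trans (le_of_eq ?_) h
    rw [rowForm, ← Finset.sum_coe_sort J]
    congr 2
    refine Finset.sum_congr rfl fun u _ => ?_
    rw [← Finset.sum_coe_sort J]
    rfl
  · intro v
    have e : ∀ u : J, (Matrix.of fun u y : J => inner ℂ (xi u.1) (x (xi y.1))).mulVec v u =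
        inner ℂ (xi u.1) (x (∑ y : J, v y • xi y.1)) := by
      intro u
      rw [map_sum, inner_sum]
      refine Finset.sum_congr rfl fun y _ => ?_
      rw [map_smul, inner_smul_right, mul_comm]
      rfl
    have ho : Orthonormal ℂ (fun y : J => xi y.1) :=
      orthonormal_xi.comp _ Subtype.val_injective
    simp only [e]
    calc _ ≤ ‖x (∑ y : J, v y • xi y.1)‖ ^ 2 :=
          ho.sum_inner_products_le _ (s := Finset.univ)
      _ ≤ (‖x‖ * ‖∑ y : J, v y • xi y.1‖) ^ 2 :=
          pow_le_pow_left₀ (norm_nonneg _) (x.le_opNorm _) 2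
      _ = _ := by
          rw [mul_pow]
          congr 1
          have h2 := ho.inner_sum v v Finset.univ
          rw [inner_self_eq_norm_sq_to_K] at h2
          simp only [Complex.conj_mul'] at h2
          refine Complex.ofReal_injective ?_
          push_cast
          exact h2

theorem rowForm_sub (J : Finset E.Path) (d d' b : E.Path → B)
    (x : E.FockSpace →L[ℂ] E.FockSpace) :
    rowForm J (fun u => d u - d' u) b x = rowForm J d b x - rowForm J d' b x := by
  simp only [rowForm, sub_mul, smul_sub, Finset.sum_sub_distrib]

theorem rowForm_mul_left (J : Finset E.Path) (c : B) (d b : E.Path → B)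
    (x : E.FockSpace →L[ℂ] E.FockSpace) :
    rowForm J (fun u => c * d u) b x = c * rowForm J d b x := by
  simp only [rowForm, Finset.mul_sum, mul_smul_comm, mul_assoc]

theorem rowForm_add_right (J : Finset E.Path) (d b : E.Path → B)
    (x y : E.FockSpace →L[ℂ] E.FockSpace) :
    rowForm J d b (x + y) = rowForm J d b x + rowForm J d b y := by
  simp only [rowForm, add_apply, inner_add_right, add_smul,
    Finset.sum_add_distrib]

theorem rowForm_smul_right (J : Finset E.Path) (d b : E.Path → B) (c : ℂ)
    (x : E.FockSpace →L[ℂ] E.FockSpace) :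
    rowForm J d b (c • x) = c • rowForm J d b x := by
  simp only [rowForm, smul_apply, inner_smul_right, mul_smul, Finset.smul_sum]

theorem rowForm_one (J : Finset E.Path) (d b : E.Path → B) :
    rowForm J d b 1 = ∑ u ∈ J, d u * star (b u) := by
  classical
  refine Finset.sum_congr rfl fun u hu => ?_
  rw [Finset.sum_eq_single u]
  · rw [one_apply_eq_self, inner_xi_xi, if_pos rfl, one_smul]
  · intro y _ hy
    rw [one_apply_eq_self, inner_xi_xi, if_neg hy.symm, zero_smul]
  · intro h
    exact absurd hu h

/-- Left multiplication by a partial isometry of the basis only relabels the rows of the matrix, so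
it can be moved onto the left row `d`. -/
theorem rowForm_pequivOp_mul (J : Finset E.Path) (d b : E.Path → B) (f : E.Path ≃. E.Path)
    (x : E.FockSpace →L[ℂ] E.FockSpace)
    (h : ∀ z u, f z = some u → d u ≠ 0 → z ∈ J ∧ u ∈ J) :
    rowForm J d b (pequivOp f * x) = rowForm J (fun z => (f z).elim 0 d) b x := by
  rw [rowForm, rowForm]
  conv_lhs => rw [Finset.sum_comm]
  conv_rhs => rw [Finset.sum_comm]
  refine Finset.sum_congr rfl fun y _ => ?_
  simp only [mul_apply_eq_comp, inner_xi_pequivOp]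
  rw [sum_symm_elim_smul f J _ (fun u => d u * star (b y))]
  · refine Finset.sum_congr rfl fun z _ => ?_
    cases f z <;> simp
  · intro z u hzu hc
    exact h z u hzu fun h0 => hc (by rw [h0, zero_mul])

end RowForm

/-! ### Rows of words and their failure to intertwine the shifts -/

section Rows

open DirGraph.Path

variable {E : DirGraph.{u}} [Finite E.Vert] [Finite E.Edge] {n : ℕ} [NeZero n]
  {B : Type w} [NonUnitalCStarAlgebra B]

/-- The row with entries `a_k A_z + c_k C_z`, `k = |z|`, where `A` and `C` are the two kinds of words
of a Toeplitz family. -/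
def row (V : (E.periodGraph n).Edge → B) (R Q : (E.periodGraph n).Vert → B) (a c : ℕ → ℝ)
    (z : E.Path) : B :=
  a z.length • word V Q z + c z.length • word V (R - Q) z

namespace IsToeplitzFamily

variable {V : (E.periodGraph n).Edge → B} {R Q : (E.periodGraph n).Vert → B}
  (hT : IsToeplitzFamily V R Q)

omit [Finite E.Vert] [Finite E.Edge] in
theorem _root_.DirGraph.word_mul_proj {X : (E.periodGraph n).Vert → B}
    (hX : ∀ x, IsStarProjection (X x)) (z : E.Path) :
    word V X z * X ((nil z.src).remVert n) = word V X z := by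
  induction z using Path.induction_on with
  | nil x => exact (hX _).isIdempotentElem.eq
  | cons e z h ih =>
    rw [word_cons, mul_assoc]
    exact congrArg _ ih

include hT

/-- The two kinds of words end on the right in Q_x and in R_y − Q_y, which are orthogonal. This
removes all cross terms from `row_mul_star_row`. -/
theorem word_mul_star_word (z y : E.Path) : word V Q z * star (word V (R - Q) y) = 0 := by
  rw [← word_mul_proj hT.isProj_defect, ← word_mul_proj hT.isProj_sub y, star_mul,
    (hT.isProj_sub _).isSelfAdjoint.star_eq, mul_assoc, ← mul_assoc (Q _), Pi.sub_apply,
    hT.defect_mul_sub, zero_mul, mul_zero]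

theorem word_mul_star_word' (z y : E.Path) : word V (R - Q) z * star (word V Q y) = 0 := by
  have h := congrArg star (hT.word_mul_star_word y z)
  rwa [star_mul, star_star, star_zero] at h

theorem row_mul_star_row (a c : ℕ → ℝ) (z : E.Path) :
    row V R Q a c z * star (row V R Q a c z) =
      (a z.length ^ 2) • (word V Q z * star (word V Q z)) +
        (c z.length ^ 2) • (word V (R - Q) z * star (word V (R - Q) z)) := by
  simp only [row, star_add, star_smul, star_trivial, add_mul, mul_add, smul_mul_smul_comm,
    hT.word_mul_star_word, hT.word_mul_star_word', smul_zero, add_zero, zero_add, sq]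

theorem sum_row_mul_star_row (a c : ℕ → ℝ) (K : ℕ) :
    ∑ z ∈ E.pathsBelow K, row V R Q a c z * star (row V R Q a c z) =
      ∑ k ∈ Finset.range K, ((a k ^ 2) • levelSum V Q k + (c k ^ 2) • levelSum V (R - Q) k) := by
  rw [sum_pathsBelow]
  refine Finset.sum_congr rfl fun k _ => ?_
  rw [levelSum, levelSum, Finset.smul_sum, Finset.smul_sum, ← Finset.sum_add_distrib]
  refine Finset.sum_congr rfl fun z hz => ?_
  rw [mem_pathsOfLength] at hz
  rw [hT.row_mul_star_row, hz]

/-- The two coefficients play different roles: all levels of Q-words together have norm at most 1,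
so a uniform bound on `a` is enough, whereas each level of (R − Q)-words is only bounded by 1
separately, so the squares of `c` must be summed. -/
theorem norm_sum_row_le {a c : ℕ → ℝ} {δ : ℝ} (ha : ∀ k, a k ^ 2 ≤ δ) (K : ℕ) :
    ‖∑ z ∈ E.pathsBelow K, row V R Q a c z * star (row V R Q a c z)‖ ≤
      δ + ∑ k ∈ Finset.range K, c k ^ 2 := by
  let _ := CStarAlgebra.spectralOrder B
  have _ := CStarAlgebra.spectralOrderedRing B
  have hδ : 0 ≤ δ := (sq_nonneg _).trans (ha 0)
  rw [hT.sum_row_mul_star_row, Finset.sum_add_distrib]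
  refine (norm_add_le _ _).trans (add_le_add ?_ ?_)
  · have h1 : ∑ k ∈ Finset.range K, (a k ^ 2) • levelSum V Q k ≤
        δ • ∑ k ∈ Finset.range K, levelSum V Q k := by
      rw [Finset.smul_sum]
      exact Finset.sum_le_sum fun k _ => smul_le_smul_of_nonneg_right (ha k) (levelSum_nonneg _ _)
    refine (CStarAlgebra.norm_le_norm_of_nonneg_of_le (Finset.sum_nonneg fun _ _ =>
      smul_nonneg (sq_nonneg _) (levelSum_nonneg _ _)) h1).trans ?_
    rw [norm_smul, Real.norm_of_nonneg hδ]
    exact mul_le_of_le_one_right hδ (hT.norm_sum_levelSum_defect_le K)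
  · refine (norm_sum_le _ _).trans (Finset.sum_le_sum fun k _ => ?_)
    rw [norm_smul, Real.norm_of_nonneg (sq_nonneg _)]
    exact mul_le_of_le_one_right (sq_nonneg _) (hT.norm_levelSum_sub_le k)

omit hT [Finite E.Vert] [Finite E.Edge] in
theorem _root_.DirGraph.norm_sum_elim_le (f : E.Path ≃. E.Path) (J J' : Finset E.Path)
    (h : ∀ z ∈ J, ∀ u, f z = some u → u ∈ J') (g : E.Path → B) :
    ‖∑ z ∈ J, (f z).elim 0 g * star ((f z).elim 0 g)‖ ≤ ‖∑ u ∈ J', g u * star (g u)‖ := by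
  classical
  let _ := CStarAlgebra.spectralOrder B
  have _ := CStarAlgebra.spectralOrderedRing B
  have h1 : ∀ z, (f z).elim 0 g * star ((f z).elim 0 g) =
      (f z).elim 0 fun u => g u * star (g u) := by
    intro z
    cases f z <;> simp
  simp only [h1]
  rw [sum_elim_pequiv]
  refine CStarAlgebra.norm_le_norm_of_nonneg_of_le
    (Finset.sum_nonneg fun _ _ => mul_star_self_nonneg _)
    (Finset.sum_le_sum_of_subset_of_nonneg ?_ fun _ _ _ => mul_star_self_nonneg _)
  intro u hu
  rw [Finset.mem_biUnion] at hu
  obtain ⟨z, hz, hu⟩ := hu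
  rw [Option.mem_toFinset] at hu
  exact h z hz u hu

/-- The shift raises the level by one, so only the increments of the coefficients remain. The
truncation of `k - 1` at k = 0 is harmless, since u has positive length. -/
theorem edge_mul_row (a c : ℕ → ℝ) (p : (E.periodGraph n).Edge) (z : E.Path) :
    (shiftPEquiv n p z).elim 0 (row V R Q a c) - V p * row V R Q a c z =
      (shiftPEquiv n p z).elim 0
        (row V R Q (fun k => a k - a (k - 1)) (fun k => c k - c (k - 1))) := by
  rw [row, mul_add, mul_smul_comm, mul_smul_comm, hT.edge_mul_word hT.proj_mul_defect,
    hT.edge_mul_word hT.proj_mul_sub]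
  rcases hu : shiftPEquiv n p z with _ | u
  · simp
  · simp only [Option.elim_some, row, length_of_shiftPEquiv n hu, Nat.add_sub_cancel]
    module

/-- Besides the increments there is a boundary term at length zero: no path precedes a vertex, yet
V_p⋆ need not kill the word ending in R − Q there. -/
theorem star_edge_mul_row (a c : ℕ → ℝ) (p : (E.periodGraph n).Edge) (u : E.Path) :
    ((shiftPEquiv n p).symm u).elim 0 (row V R Q a c) - star (V p) * row V R Q a c u =
      ((shiftPEquiv n p).symm u).elim 0
        (row V R Q (fun k => a k - a (k + 1)) (fun k => c k - c (k + 1))) -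
      if u.length = 0 then star (V p) * (c 0 • word V (R - Q) u) else 0 := by
  induction u using Path.induction_on with
  | nil x =>
    rw [shiftPEquiv_symm_nil, Option.elim_none, Option.elim_none, length_nil, if_pos rfl, row,
      mul_add, word_nil, mul_smul_comm, hT.star_edge_mul_defect, smul_zero, zero_add, length_nil]
  | cons e z h =>
    rw [length_cons, if_neg z.length.succ_ne_zero, sub_zero, row, mul_add, mul_smul_comm,
      mul_smul_comm, hT.star_edge_mul_word_cons hT.proj_mul_defect,
      hT.star_edge_mul_word_cons hT.proj_mul_sub]
    rcases hu : (shiftPEquiv n p).symm (cons e z h) with _ | z'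
    · simp
    · obtain ⟨rfl, _⟩ := (shiftPEquiv_eq_some_cons_iff n).1 ((PEquiv.eq_some_iff _).1 hu)
      simp only [Option.elim_some, row, length_cons]
      module

theorem norm_edge_le (p : (E.periodGraph n).Edge) : ‖V p‖ ≤ 1 := by
  have h1 := CStarRing.norm_star_mul_self (x := V p)
  rw [hT.star_edge_mul_self] at h1
  have h2 := (hT.isProj ((E.periodGraph n).s p)).norm_le
  nlinarith [norm_nonneg (V p)]

theorem norm_sum_edge_le {a c : ℕ → ℝ} (p : (E.periodGraph n).Edge) {δ : ℝ}
    (ha : ∀ k, (a k - a (k - 1)) ^ 2 ≤ δ) (K : ℕ) :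
    ‖∑ z ∈ E.pathsBelow K,
      ((shiftPEquiv n p z).elim 0 (row V R Q a c) - V p * row V R Q a c z) *
        star ((shiftPEquiv n p z).elim 0 (row V R Q a c) - V p * row V R Q a c z)‖ ≤
      δ + ∑ k ∈ Finset.range (K + 1), (c k - c (k - 1)) ^ 2 := by
  simp only [hT.edge_mul_row]
  refine (norm_sum_elim_le _ _ (E.pathsBelow (K + 1)) ?_ _).trans (hT.norm_sum_row_le ha _)
  intro z hz u hu
  have h := length_of_shiftPEquiv n hu
  rw [mem_pathsBelow] at hz ⊢
  omega

theorem norm_sum_star_edge_le {a c : ℕ → ℝ} (p : (E.periodGraph n).Edge) {δ : ℝ}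
    (ha : ∀ k, (a k - a (k + 1)) ^ 2 ≤ δ) (K : ℕ) :
    ‖∑ u ∈ E.pathsBelow K,
      (((shiftPEquiv n p).symm u).elim 0 (row V R Q a c) - star (V p) * row V R Q a c u) *
        star (((shiftPEquiv n p).symm u).elim 0 (row V R Q a c) -
          star (V p) * row V R Q a c u)‖ ≤
      δ + ∑ k ∈ Finset.range K, (c k - c (k + 1)) ^ 2 + c 0 ^ 2 := by
  classical
  set g := row V R Q (fun k => a k - a (k + 1)) (fun k => c k - c (k + 1)) with hg
  -- The increment and the boundary term live on disjoint sets of paths, so their products do not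
  -- mix.
  have h1 : ∀ u : E.Path,
      (((shiftPEquiv n p).symm u).elim 0 (row V R Q a c) - star (V p) * row V R Q a c u) *
        star (((shiftPEquiv n p).symm u).elim 0 (row V R Q a c) -
          star (V p) * row V R Q a c u) =
      ((shiftPEquiv n p).symm u).elim 0 g * star (((shiftPEquiv n p).symm u).elim 0 g) +
      if u.length = 0 then (c 0 ^ 2) •
        (star (V p) * (word V (R - Q) u * star (word V (R - Q) u)) * V p) else 0 := by
    intro u
    rw [hT.star_edge_mul_row, ← hg]
    split_ifs with h
    · rw [eq_nil_of_length_eq_zero h, shiftPEquiv_symm_nil]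
      simp only [Option.elim_none, zero_sub, star_neg, neg_mul_neg, zero_mul, zero_add, star_mul,
        star_star, mul_smul_comm, smul_mul_assoc, star_smul, star_trivial, smul_smul, sq, mul_assoc]
    · simp
  simp only [h1]
  rw [Finset.sum_add_distrib]
  refine (norm_add_le _ _).trans (add_le_add ?_ ?_)
  · refine (norm_sum_elim_le _ _ (E.pathsBelow K) ?_ _).trans (hT.norm_sum_row_le ha _)
    intro u hu z hz
    have h := length_of_shiftPEquiv n ((PEquiv.eq_some_iff _).1 hz)
    rw [mem_pathsBelow] at hu ⊢
    omega
  · rcases Nat.eq_zero_or_pos K with rfl | hK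
    · rw [sum_pathsBelow]
      simpa using sq_nonneg _
    · have h2 : (E.pathsBelow K).filter (fun u => u.length = 0) = E.pathsOfLength 0 := by
        ext u
        simp only [Finset.mem_filter, mem_pathsBelow, mem_pathsOfLength]
        omega
      rw [← Finset.sum_filter, h2, ← Finset.smul_sum, ← Finset.sum_mul, ← Finset.mul_sum,
        norm_smul, Real.norm_of_nonneg (sq_nonneg _)]
      refine mul_le_of_le_one_right (sq_nonneg _) ((norm_mul_le _ _).trans ?_)
      refine mul_le_one₀ ((norm_mul_le _ _).trans ?_) (norm_nonneg _) (hT.norm_edge_le p)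
      rw [norm_star]
      exact mul_le_one₀ (hT.norm_edge_le p) (norm_nonneg _) (hT.norm_levelSum_sub_le 0)

end IsToeplitzFamily

end Rows

/-! ### Fejér coefficients, averaging and the norm estimate -/

section Fejer

open DirGraph.Path Filter Topology

/-- An instance of (√a − √b)² ≤ |a − b|. -/
theorem sq_sqrt_sub_sqrt_le_one {a b : ℕ} (h : a ≤ b + 1) (h' : b ≤ a + 1) :
    (√(a : ℝ) - √(b : ℝ)) ^ 2 ≤ 1 := by
  have ha := Real.sq_sqrt (Nat.cast_nonneg (α := ℝ) a)
  have hb := Real.sq_sqrt (Nat.cast_nonneg (α := ℝ) b)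
  have ha' := Real.sqrt_nonneg (a : ℝ)
  have hb' := Real.sqrt_nonneg (b : ℝ)
  have h1 : (a : ℝ) ≤ b + 1 := by exact_mod_cast h
  have h2 : (b : ℝ) ≤ a + 1 := by exact_mod_cast h'
  rcases le_total (√(a : ℝ)) (√(b : ℝ)) with h3 | h3 <;> nlinarith

theorem succ_div_le (k n : ℕ) [NeZero n] : (k + 1) / n ≤ k / n + 1 := by
  rw [← Nat.add_div_right k (NeZero.pos n)]
  exact Nat.div_le_div_right (Nat.add_le_add_left (NeZero.pos n) k)

/-- The coefficient of the defect words in the Fejér row. -/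
def fejerA (n N k : ℕ) : ℝ := √((N - k / n : ℕ) : ℝ)

/-- The coefficient of the remaining words in the Fejér row. -/
def fejerC (n N k : ℕ) : ℝ := if k < n * N then 1 else 0

theorem fejerA_sq (n N k : ℕ) : fejerA n N k ^ 2 = (N - k / n : ℕ) :=
  Real.sq_sqrt (Nat.cast_nonneg _)

theorem fejerA_sub_succ_sq_le (n : ℕ) [NeZero n] (N k : ℕ) :
    (fejerA n N k - fejerA n N (k + 1)) ^ 2 ≤ 1 := by
  have h1 := succ_div_le k n
  have h2 : k / n ≤ (k + 1) / n := Nat.div_le_div_right k.le_succ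
  exact sq_sqrt_sub_sqrt_le_one (by omega) (by omega)

theorem fejerA_sub_pred_sq_le (n : ℕ) [NeZero n] (N k : ℕ) :
    (fejerA n N k - fejerA n N (k - 1)) ^ 2 ≤ 1 := by
  rcases k with _ | k
  · simp
  · rw [Nat.add_sub_cancel, ← neg_sub, neg_sq]
    exact fejerA_sub_succ_sq_le n N k

theorem fejerC_sq_le (n N k : ℕ) : fejerC n N k ^ 2 ≤ 1 := by
  rw [fejerC]
  split_ifs <;> simp

/-- The cutoff jumps only once, between nN − 1 and nN. -/
theorem sum_fejerC_sub_succ_sq_le (n N K : ℕ) :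
    ∑ k ∈ Finset.range K, (fejerC n N k - fejerC n N (k + 1)) ^ 2 ≤ 1 := by
  have h : ∀ k, (fejerC n N k - fejerC n N (k + 1)) ^ 2 ≤ if k + 1 = n * N then 1 else 0 := by
    intro k
    simp only [fejerC]
    split_ifs <;> first | omega | norm_num
  refine (Finset.sum_le_sum fun k _ => h k).trans ?_
  rcases hm : n * N with _ | m
  · simp
  · simp only [Nat.succ.injEq, Finset.sum_ite_eq']
    split_ifs <;> simp

theorem sum_fejerC_sub_pred_sq_le (n N K : ℕ) :
    ∑ k ∈ Finset.range K, (fejerC n N k - fejerC n N (k - 1)) ^ 2 ≤ 1 := by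
  rcases K with _ | K
  · simp
  · rw [Finset.sum_range_succ']
    simp only [Nat.add_sub_cancel, Nat.zero_sub, sub_self, ne_eq, OfNat.ofNat_ne_zero,
      not_false_eq_true, zero_pow, add_zero]
    refine le_trans (le_of_eq ?_) (sum_fejerC_sub_succ_sq_le n N K)
    refine Finset.sum_congr rfl fun k _ => ?_
    rw [← neg_sub, neg_sq]

variable {E : DirGraph.{u}} [Finite E.Vert] [Finite E.Edge] {n : ℕ} [NeZero n]
  {B : Type w} [NonUnitalCStarAlgebra B]

/-- The Fejér row of a Toeplitz family. -/
def fejerRow (V : (E.periodGraph n).Edge → B) (R Q : (E.periodGraph n).Vert → B) (N : ℕ) :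
    E.Path → B :=
  row V R Q (fejerA n N) (fejerC n N)

omit [Finite E.Vert] [Finite E.Edge] in
theorem fejerRow_eq_zero {V : (E.periodGraph n).Edge → B} {R Q : (E.periodGraph n).Vert → B}
    {N : ℕ} {z : E.Path} (h : n * N ≤ z.length) : fejerRow V R Q N z = 0 := by
  have h1 : N ≤ z.length / n := by
    rw [Nat.le_div_iff_mul_le (NeZero.pos n), mul_comm]
    exact h
  rw [fejerRow, row, fejerA, fejerC, if_neg (by omega), Nat.sub_eq_zero_of_le h1]
  simp

/-- The unnormalized Fejér map from operators on the Fock space to the algebra of a Toeplitz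
family. -/
def fejerMap (V : (E.periodGraph n).Edge → B) (R Q : (E.periodGraph n).Vert → B) (N : ℕ) :
    (E.FockSpace →L[ℂ] E.FockSpace) → B :=
  -- The row vanishes from length nN on. The extra level serves the adjoint shifts, for which
  -- `rowForm_pequivOp_mul` needs ez in the set whenever the row is nonzero at z.
  rowForm (E.pathsBelow (n * N + 1)) (fejerRow V R Q N) (fejerRow V R Q N)

namespace IsToeplitzFamily

variable {V : (E.periodGraph n).Edge → B} {R Q : (E.periodGraph n).Vert → B}
  (hT : IsToeplitzFamily V R Q)

include hT

/-- The squares of the Fejér coefficients are exactly the weights in `sum_weighted_levelSum`. -/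
theorem sum_fejerRow (N : ℕ) : ∑ z ∈ E.pathsBelow (n * N + 1),
    fejerRow V R Q N z * star (fejerRow V R Q N z) = (N : ℝ) • ∑ x, R x := by
  rw [← hT.sum_weighted_levelSum N]
  simp only [fejerRow]
  rw [hT.sum_row_mul_star_row, Finset.sum_range_succ]
  have h0 : fejerA n N (n * N) = 0 := by
    rw [fejerA, Nat.mul_div_cancel_left _ (NeZero.pos n)]
    simp
  have h1 : fejerC n N (n * N) = 0 := if_neg (lt_irrefl _)
  rw [h0, h1, zero_pow two_ne_zero, zero_smul, zero_smul, add_zero, add_zero]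
  refine Finset.sum_congr rfl fun k hk => ?_
  have hk' := Finset.mem_range.1 hk
  have h2 : k / n ≤ N := by
    rw [mul_comm] at hk'
    exact (Nat.div_lt_of_lt_mul (by rwa [mul_comm])).le
  rw [fejerA_sq, Nat.cast_sub h2, fejerC, if_pos hk', one_pow, one_smul]

theorem norm_sum_fejerRow_le (N : ℕ) : ‖∑ z ∈ E.pathsBelow (n * N + 1),
    fejerRow V R Q N z * star (fejerRow V R Q N z)‖ ≤ N := by
  rw [hT.sum_fejerRow, norm_smul, Real.norm_of_nonneg (Nat.cast_nonneg _)]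
  exact mul_le_of_le_one_right (Nat.cast_nonneg _) hT.isProj_sum.norm_le

theorem norm_fejerMap_le (N : ℕ) (x : E.FockSpace →L[ℂ] E.FockSpace) :
    ‖fejerMap V R Q N x‖ ≤ N * ‖x‖ := by
  refine le_of_sq_le_sq ((norm_rowForm_sq_le _ _ _ x).trans ?_) (by positivity)
  have h := hT.norm_sum_fejerRow_le N
  rw [mul_pow, mul_comm, sq (N : ℝ)]
  gcongr

/-- The difference is again a row form. Its left row, the intertwining error, has squared norm
bounded independently of N; only the right row contributes N. -/
theorem norm_fejerMap_edge_sub_sq_le (N : ℕ) (p : (E.periodGraph n).Edge)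
    (x : E.FockSpace →L[ℂ] E.FockSpace) :
    ‖fejerMap V R Q N (pequivOp (shiftPEquiv n p) * x) - V p * fejerMap V R Q N x‖ ^ 2 ≤
      ‖x‖ ^ 2 * (3 * N) := by
  rw [fejerMap, rowForm_pequivOp_mul, ← rowForm_mul_left, ← rowForm_sub]
  · refine (norm_rowForm_sq_le _ _ _ x).trans ?_
    have h1 := hT.norm_sum_edge_le (c := fejerC n N) p (fejerA_sub_pred_sq_le n N) (n * N + 1)
    have h2 := sum_fejerC_sub_pred_sq_le n N (n * N + 1 + 1)
    have h3 := hT.norm_sum_fejerRow_le N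
    gcongr
    -- The increments of `fejerA` and of `fejerC` contribute 1 each; the constant 3 is the one
    -- needed for the adjoint, where `fejerC n N 0 ^ 2` is added.
    exact h1.trans (by linarith)
  · intro z u hzu hu
    have h1 := length_of_shiftPEquiv n hzu
    have h2 : u.length < n * N := not_le.1 fun h => hu (fejerRow_eq_zero h)
    simp only [mem_pathsBelow]
    omega

theorem norm_fejerMap_star_edge_sub_sq_le (N : ℕ) (p : (E.periodGraph n).Edge)
    (x : E.FockSpace →L[ℂ] E.FockSpace) :
    ‖fejerMap V R Q N (star (pequivOp (shiftPEquiv n p)) * x) -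
      star (V p) * fejerMap V R Q N x‖ ^ 2 ≤ ‖x‖ ^ 2 * (3 * N) := by
  rw [star_pequivOp, fejerMap, rowForm_pequivOp_mul, ← rowForm_mul_left, ← rowForm_sub]
  · refine (norm_rowForm_sq_le _ _ _ x).trans ?_
    have h1 := hT.norm_sum_star_edge_le (c := fejerC n N) p (fejerA_sub_succ_sq_le n N)
      (n * N + 1)
    have h2 := sum_fejerC_sub_succ_sq_le n N (n * N + 1)
    have h3 := hT.norm_sum_fejerRow_le N
    have h4 := fejerC_sq_le n N 0
    gcongr
    exact h1.trans (by linarith)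
  · intro u z huz hz
    have h1 := length_of_shiftPEquiv n ((PEquiv.eq_some_iff _).1 huz)
    have h2 : z.length < n * N := not_le.1 fun h => hz (fejerRow_eq_zero h)
    simp only [mem_pathsBelow]
    omega

theorem fejerMap_one (N : ℕ) : fejerMap V R Q N 1 = (N : ℝ) • ∑ x, R x := by
  rw [fejerMap, rowForm_one, hT.sum_fejerRow]

theorem edge_mul_sum (p : (E.periodGraph n).Edge) : V p * ∑ x, R x = V p := by
  rw [Finset.mul_sum, Finset.sum_eq_single ((E.periodGraph n).s p), hT.mul_proj_source]
  · intro x _ hx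
    exact hT.mul_proj_of_ne hx
  · simp

theorem sum_mul_edge (p : (E.periodGraph n).Edge) : (∑ x, R x) * V p = V p := by
  rw [Finset.sum_mul, Finset.sum_eq_single ((E.periodGraph n).r p), hT.proj_range_mul]
  · intro x _ hx
    rw [← hT.proj_range_mul, ← mul_assoc, hT.orthogonal _ _ hx, zero_mul]
  · simp

end IsToeplitzFamily

/-- The operator `T` intertwines the Fejér maps with left multiplication by `a`,
asymptotically. -/
def IsFejerLimit (V : (E.periodGraph n).Edge → B) (R Q : (E.periodGraph n).Vert → B) (a : B)
    (T : E.FockSpace →L[ℂ] E.FockSpace) : Prop :=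
  ∀ x, Tendsto (fun N : ℕ => ((N : ℝ)⁻¹) • (fejerMap V R Q N (T * x) - a * fejerMap V R Q N x))
    atTop (𝓝 0)

namespace IsFejerLimit

variable {V : (E.periodGraph n).Edge → B} {R Q : (E.periodGraph n).Vert → B} {a b : B}
    {S T : E.FockSpace →L[ℂ] E.FockSpace}

theorem zero : IsFejerLimit V R Q 0 0 := by
  intro x
  simp [fejerMap, rowForm]

theorem add (ha : IsFejerLimit V R Q a S) (hb : IsFejerLimit V R Q b T) :
    IsFejerLimit V R Q (a + b) (S + T) := by
  intro x
  have h := (ha x).add (hb x)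
  rw [add_zero] at h
  refine h.congr fun N => ?_
  rw [← smul_add, add_mul, add_mul, fejerMap, rowForm_add_right]
  congr 1
  abel

theorem smul (c : ℂ) (ha : IsFejerLimit V R Q a S) : IsFejerLimit V R Q (c • a) (c • S) := by
  intro x
  have h := (ha x).const_smul c
  rw [smul_zero] at h
  refine h.congr fun N => ?_
  rw [smul_mul_assoc, smul_mul_assoc, fejerMap, rowForm_smul_right, ← smul_sub, smul_comm]

/-- F(STx) − abF(x) = [F(S(Tx)) − aF(Tx)] + a[F(Tx) − bF(x)]. The first bracket uses the property of
S at Tx, which is why `IsFejerLimit` quantifies over all x. -/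
theorem mul (ha : IsFejerLimit V R Q a S) (hb : IsFejerLimit V R Q b T) :
    IsFejerLimit V R Q (a * b) (S * T) := by
  intro x
  have h := (ha (T * x)).add ((hb x).const_mul a)
  rw [mul_zero, add_zero] at h
  refine h.congr fun N => ?_
  rw [mul_smul_comm, ← smul_add, mul_assoc, mul_assoc, mul_sub]
  congr 1
  abel

theorem of_norm_sq_le {M : ℝ}
    (h : ∀ (N : ℕ) x, ‖fejerMap V R Q N (T * x) - a * fejerMap V R Q N x‖ ^ 2 ≤
      ‖x‖ ^ 2 * (M * N)) : IsFejerLimit V R Q a T := by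
  intro x
  have h1 : Tendsto (fun N : ℕ => √(‖x‖ ^ 2 * M * ((N : ℝ)⁻¹))) atTop (𝓝 0) := by
    have h2 := (tendsto_inv_atTop_nhds_zero_nat (𝕜 := ℝ)).const_mul (‖x‖ ^ 2 * M)
    rw [mul_zero] at h2
    simpa using h2.sqrt
  refine squeeze_zero_norm (fun N => ?_) h1
  refine Real.le_sqrt_of_sq_le ?_
  rw [norm_smul, mul_pow, norm_inv, Real.norm_of_nonneg (Nat.cast_nonneg N)]
  rcases Nat.eq_zero_or_pos N with rfl | hN
  · simp
  · have hN' : (0 : ℝ) < N := Nat.cast_pos.2 hN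
    calc _ ≤ ((N : ℝ)⁻¹) ^ 2 * (‖x‖ ^ 2 * (M * N)) := by
          gcongr
          exact h N x
      _ = _ := by
          field_simp

/-- At x = 1 the property says that N⁻¹F_N(T) tends to a, and the maps N⁻¹F_N are contractive. -/
theorem norm_le (hT : IsToeplitzFamily V R Q) (ha : IsFejerLimit V R Q a T)
    (h1 : a * ∑ x, R x = a) : ‖a‖ ≤ ‖T‖ := by
  have h2 : Tendsto (fun N : ℕ => ((N : ℝ)⁻¹) • fejerMap V R Q N T) atTop (𝓝 a) := by
    have h3 := (ha 1).add_const a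
    rw [zero_add] at h3
    refine h3.congr' ?_
    filter_upwards [eventually_gt_atTop 0] with N hN
    have hN' : (N : ℝ) ≠ 0 := Nat.cast_ne_zero.2 hN.ne'
    rw [hT.fejerMap_one, mul_smul_comm, h1, mul_one, smul_sub, smul_smul, inv_mul_cancel₀ hN',
      one_smul, sub_add_cancel]
  refine le_of_tendsto h2.norm ?_
  filter_upwards [eventually_gt_atTop 0] with N hN
  have hN' : (0 : ℝ) < N := Nat.cast_pos.2 hN
  rw [norm_smul, norm_inv, Real.norm_of_nonneg hN'.le, inv_mul_le_iff₀ hN']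
  exact hT.norm_fejerMap_le N T

end IsFejerLimit

/-- A representation of the algebra of a Toeplitz family which sends the family to the shifts on
the Fock space is isometric. -/
theorem IsToeplitzFamily.norm_le_of_map_edge {V : (E.periodGraph n).Edge → B}
    {R Q : (E.periodGraph n).Vert → B} (hT : IsToeplitzFamily V R Q)
    (Φ : B →⋆ₙₐ[ℂ] (E.FockSpace →L[ℂ] E.FockSpace))
    (hΦ : ∀ p, Φ (V p) = pequivOp (shiftPEquiv n p)) {a : B}
    (ha : a ∈ NonUnitalStarAlgebra.adjoin ℂ (Set.range V)) : ‖a‖ ≤ ‖Φ a‖ := by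
  -- The property concerns left multiplication and is not formally invariant under the star, so the
  -- induction carries `a` and `star a` together.
  suffices h : (IsFejerLimit V R Q a (Φ a) ∧ a * ∑ x, R x = a) ∧
      (IsFejerLimit V R Q (star a) (Φ (star a)) ∧ star a * ∑ x, R x = star a) from
    h.1.1.norm_le hT h.1.2
  induction ha using NonUnitalStarAlgebra.adjoin_induction with
  | mem a ha =>
    obtain ⟨p, rfl⟩ := ha
    refine ⟨⟨.of_norm_sq_le (M := 3) fun N x => ?_, hT.edge_mul_sum p⟩,
      .of_norm_sq_le (M := 3) fun N x => ?_, ?_⟩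
    · rw [hΦ]
      exact hT.norm_fejerMap_edge_sub_sq_le N p x
    · rw [map_star, hΦ]
      exact hT.norm_fejerMap_star_edge_sub_sq_le N p x
    · have h := congrArg star (hT.sum_mul_edge p)
      rwa [star_mul, hT.isProj_sum.isSelfAdjoint.star_eq] at h
  | add a b _ _ iha ihb =>
    rw [star_add, map_add, map_add, add_mul, add_mul]
    exact ⟨⟨iha.1.1.add ihb.1.1, by rw [iha.1.2, ihb.1.2]⟩,
      iha.2.1.add ihb.2.1, by rw [iha.2.2, ihb.2.2]⟩
  | zero =>
    rw [star_zero, map_zero, zero_mul]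
    exact ⟨⟨.zero, rfl⟩, .zero, rfl⟩
  | mul a b _ _ iha ihb =>
    rw [star_mul, map_mul, map_mul, mul_assoc, mul_assoc]
    exact ⟨⟨iha.1.1.mul ihb.1.1, by rw [ihb.1.2]⟩, ihb.2.1.mul iha.2.1, by rw [iha.2.2]⟩
  | smul c a _ iha =>
    rw [star_smul, map_smul, map_smul, smul_mul_assoc, smul_mul_assoc]
    exact ⟨⟨iha.1.1.smul c, by rw [iha.1.2]⟩, iha.2.1.smul _, by rw [iha.2.2]⟩
  | star a _ iha =>
    rw [star_star]
    exact ⟨iha.2, iha.1⟩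

end Fejer

/-! ### The Toeplitz family inside a Cuntz–Krieger E[n]-family -/

section CuntzKrieger

open DirGraph.Path

variable {E : DirGraph.{u}} {n : ℕ} [NeZero n]

/-- The edge `(e, v)` of `E(n)` obtained from the edge `(e, c(v))` of `E[n]`. -/
def edgeOfCopy (n : ℕ) [NeZero n] (q : {p : E.Edge × E.Vert // E.s p.1 = p.2}) :
    (E.periodGraph n).Edge :=
  remEdge n q.1.1 (nil q.1.2) (q.2.trans (range_nil q.1.2).symm)

/-- The edge `(e, c(r(w)))` of `E[n]` obtained from the edge `(e, w)` of `E(n)`. -/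
def copyEdge (p : (E.periodGraph n).Edge) : {p : E.Edge × E.Vert // E.s p.1 = p.2} :=
  ⟨(p.1.1, p.1.2.1.range), p.2⟩

theorem remVert_nil_val (v : E.Vert) : ((nil v).remVert n).1 = nil v :=
  rem_eq_self (NeZero.pos n)

theorem eq_remVert_nil {x : (E.periodGraph n).Vert} (hx : x.1.length = 0) :
    x = (nil x.1.range).remVert n := by
  refine Subtype.ext ?_
  rw [remVert_nil_val]
  exact eq_nil_of_length_eq_zero hx

theorem copyEdge_edgeOfCopy (q : {p : E.Edge × E.Vert // E.s p.1 = p.2}) :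
    copyEdge (edgeOfCopy n q) = q := by
  refine Subtype.ext (Prod.ext rfl ?_)
  exact congrArg Path.range (remVert_nil_val (n := n) q.1.2)

theorem edgeOfCopy_copyEdge {p : (E.periodGraph n).Edge}
    (hp : ((E.periodGraph n).s p).1.length = 0) : edgeOfCopy n (copyEdge p) = p :=
  (remEdge_eq_iff n).2 ⟨rfl, (eq_remVert_nil hp).symm⟩

theorem length_s_edgeOfCopy (q : {p : E.Edge × E.Vert // E.s p.1 = p.2}) :
    ((E.periodGraph n).s (edgeOfCopy n q)).1.length = 0 := by
  change ((nil q.1.2).remVert n).1.length = 0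
  rw [remVert_nil_val]
  rfl

/-- A vertex of `E(n)` as a vertex of `E[n]`. -/
def baseVert (x : (E.periodGraph n).Vert) : (E.augPeriodGraph n).Vert := Sum.inl x

/-- The copy `c(v)` of a vertex. -/
def copyVert (n : ℕ) [NeZero n] (v : E.Vert) : (E.augPeriodGraph n).Vert := Sum.inr v

/-- An edge of `E(n)` as an edge of `E[n]`. -/
def baseEdge (p : (E.periodGraph n).Edge) : (E.augPeriodGraph n).Edge := Sum.inl p

/-- An edge `(e, c(v))` of `E[n]`. -/
def srcEdge (n : ℕ) [NeZero n] (q : {p : E.Edge × E.Vert // E.s p.1 = p.2}) :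
    (E.augPeriodGraph n).Edge := Sum.inr q

theorem augVert_cases (x : (E.augPeriodGraph n).Vert) :
    (∃ y, x = baseVert y) ∨ ∃ v, x = copyVert n v :=
  match x with
  | .inl y => .inl ⟨y, rfl⟩
  | .inr v => .inr ⟨v, rfl⟩

theorem augEdge_cases (f : (E.augPeriodGraph n).Edge) :
    (∃ p, f = baseEdge p) ∨ ∃ q, f = srcEdge n q :=
  match f with
  | .inl p => .inl ⟨p, rfl⟩
  | .inr q => .inr ⟨q, rfl⟩

theorem baseVert_injective : Function.Injective (baseVert (E := E) (n := n)) :=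
  Sum.inl_injective

theorem copyVert_injective : Function.Injective (copyVert (E := E) n) := Sum.inr_injective

theorem baseEdge_injective : Function.Injective (baseEdge (E := E) (n := n)) :=
  Sum.inl_injective

theorem srcEdge_injective : Function.Injective (srcEdge (E := E) n) := Sum.inr_injective

theorem baseVert_ne_copyVert (x : (E.periodGraph n).Vert) (v : E.Vert) :
    baseVert x ≠ copyVert n v := Sum.inl_ne_inr

theorem baseEdge_ne_srcEdge (p : (E.periodGraph n).Edge)
    (q : {p : E.Edge × E.Vert // E.s p.1 = p.2}) : baseEdge p ≠ srcEdge n q := Sum.inl_ne_inr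

theorem s_baseEdge (p : (E.periodGraph n).Edge) :
    (E.augPeriodGraph n).s (baseEdge p) = baseVert ((E.periodGraph n).s p) := rfl

theorem s_srcEdge (q : {p : E.Edge × E.Vert // E.s p.1 = p.2}) :
    (E.augPeriodGraph n).s (srcEdge n q) = copyVert n q.1.2 := rfl

theorem r_baseEdge (p : (E.periodGraph n).Edge) :
    (E.augPeriodGraph n).r (baseEdge p) = baseVert ((E.periodGraph n).r p) := rfl

/-- The cases n > 1 and n = 1 in the definition of E[n] are those of E(n) at a vertex of length
zero: (e, c(v)) is a twin of (e, v) with the same range. -/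
theorem r_srcEdge (q : {p : E.Edge × E.Vert // E.s p.1 = p.2}) :
    (E.augPeriodGraph n).r (srcEdge n q) = baseVert ((E.periodGraph n).r (edgeOfCopy n q)) := by
  rw [edgeOfCopy, r_remEdge]
  refine congrArg baseVert ?_
  by_cases h : 1 < n
  · exact (dif_pos h).trans (remVert_of_lt n (z := cons q.1.1 (nil q.1.2) q.2) h).symm
  · refine (dif_neg h).trans (Subtype.ext (rem_cons_of_eq (z := nil q.1.2) q.2 ?_).symm)
    have := NeZero.pos n
    rw [length_nil, Nat.zero_mod]
    omega

theorem exists_path_of_noSources (hE : E.NoSources) (k : ℕ) (v : E.Vert) :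
    ∃ z : E.Path, z.length = k ∧ z.range = v := by
  induction k generalizing v with
  | zero => exact ⟨nil v, rfl, rfl⟩
  | succ k ih =>
    obtain ⟨e, he⟩ := hE v
    obtain ⟨z, hz, hz'⟩ := ih (E.s e)
    exact ⟨cons e z hz'.symm, by rw [length_cons, hz], he⟩

/-- A vertex of length zero is reached by completing a period: without sources some path of length n
ends there, and its remainder is that vertex. -/
theorem exists_edge_range_eq (hE : E.NoSources) (x : (E.periodGraph n).Vert) :
    ∃ p, (E.periodGraph n).r p = x := by
  by_cases hx : x.1.length = 0
  · obtain ⟨z, hz, hz'⟩ := exists_path_of_noSources hE n x.1.range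
    have h1 : z.remVert n = x := by
      refine Subtype.ext ?_
      rw [remVert_val, eq_nil_of_length_eq_zero hx, ← hz', ← z.range_rem n]
      refine eq_nil_of_length_eq_zero ?_
      rw [length_rem, hz, Nat.mod_self]
    obtain ⟨e, z', h, rfl⟩ := exists_eq_cons_of_length_ne_zero (z := z)
      (by rw [hz]; exact NeZero.ne n)
    exact ⟨remEdge n e z' h, by rw [r_remEdge, h1]⟩
  · obtain ⟨e, z', h, hx'⟩ := exists_eq_cons_of_length_ne_zero hx
    exact ⟨remEdge n e z' h, by rw [r_remEdge, ← hx', remVert_coe]⟩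

theorem sum_edges_baseVert [Finite E.Vert] [Finite E.Edge]
    [Fintype {p : E.Edge × E.Vert // E.s p.1 = p.2}] [DecidableEq (E.periodGraph n).Vert]
    {M : Type*} [AddCommMonoid M] (x : (E.periodGraph n).Vert) (g : (E.augPeriodGraph n).Edge → M) :
    ∑ e ∈ (Set.toFinite {e | (E.augPeriodGraph n).r e = baseVert x}).toFinset, g e =
      ∑ p with (E.periodGraph n).r p = x, g (baseEdge p) +
        ∑ q with (E.periodGraph n).r (edgeOfCopy n q) = x, g (srcEdge n q) := by
  have hset := Finset.sum_disjSum (Finset.univ.filter fun p => (E.periodGraph n).r p = x)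
    (Finset.univ.filter fun q => (E.periodGraph n).r (edgeOfCopy n q) = x) g
  refine Eq.trans (Finset.sum_congr ?_ fun _ _ => rfl) hset
  refine Finset.ext fun e : (E.augPeriodGraph n).Edge => ?_
  refine (Set.Finite.mem_toFinset _).trans ?_
  rw [Set.mem_ofPred_eq]
  rcases augEdge_cases e with ⟨p, rfl⟩ | ⟨q, rfl⟩
  · rw [r_baseEdge, baseVert_injective.eq_iff]
    exact Iff.trans (by simp) Finset.inl_mem_disjSum.symm
  · rw [r_srcEdge, baseVert_injective.eq_iff]
    exact Iff.trans (by simp) Finset.inr_mem_disjSum.symm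

variable [Finite E.Vert] [Finite E.Edge] {B : Type w} [NonUnitalCStarAlgebra B]

namespace IsCKFamily

section General

variable {G : DirGraph.{u}} [Finite G.Edge] {P : G.Vert → B} {S : G.Edge → B}
  (h : G.IsCKFamily P S)

include h

theorem mul_proj_source (e : G.Edge) : S e * P (G.s e) = S e := by
  have h1 := (h.isProj (G.s e)).isIdempotentElem.eq
  have h' := (h.isProj (G.s e)).isSelfAdjoint.star_eq
  rw [← sub_eq_zero, ← CStarRing.star_mul_self_eq_zero_iff]
  simp only [star_sub, StarMul.star_mul, sub_mul, mul_sub, h', mul_assoc, h.star_mul_self, h1]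
  simp only [← mul_assoc, h.star_mul_self, h1]
  simp

theorem mul_proj_of_ne {e : G.Edge} {x : G.Vert} (hx : x ≠ G.s e) : S e * P x = 0 := by
  rw [← h.mul_proj_source, mul_assoc, h.orthogonal _ _ hx.symm, mul_zero]

theorem mul_star_of_ne {e f : G.Edge} (hef : G.s e ≠ G.s f) : S e * star (S f) = 0 := by
  rw [← h.mul_proj_source e, ← h.mul_proj_source f, StarMul.star_mul,
    (h.isProj _).isSelfAdjoint.star_eq, mul_assoc, ← mul_assoc (P _), h.orthogonal _ _ hef,
    zero_mul, mul_zero]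

end General

variable {P : (E.augPeriodGraph n).Vert → B} {S : (E.augPeriodGraph n).Edge → B}

/-- The edge elements of the Toeplitz family attached to a Cuntz–Krieger `E[n]`-family. -/
def edgeElt (S : (E.augPeriodGraph n).Edge → B) (p : (E.periodGraph n).Edge) : B :=
  S (baseEdge p) + if ((E.periodGraph n).s p).1.length = 0 then S (srcEdge n (copyEdge p)) else 0

/-- The defect projections of the Toeplitz family attached to a Cuntz–Krieger `E[n]`-family. -/
def defect (P : (E.augPeriodGraph n).Vert → B) (x : (E.periodGraph n).Vert) : B :=
  if x.1.length = 0 then P (copyVert n x.1.range) else 0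

/-- The vertex projections of the Toeplitz family attached to a Cuntz–Krieger `E[n]`-family. -/
def vertElt (P : (E.augPeriodGraph n).Vert → B) (x : (E.periodGraph n).Vert) : B :=
  P (baseVert x) + defect P x

variable (h : (E.augPeriodGraph n).IsCKFamily P S)

include h

theorem isProj_defect (x : (E.periodGraph n).Vert) : IsStarProjection (defect P x) := by
  rw [defect]
  split_ifs
  · exact h.isProj _
  · exact .zero _

theorem proj_mul_defect (x y : (E.periodGraph n).Vert) : P (baseVert x) * defect P y = 0 := by
  rw [defect]
  split_ifs
  · exact h.orthogonal _ _ (baseVert_ne_copyVert _ _)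
  · exact mul_zero _

theorem defect_mul_proj (x y : (E.periodGraph n).Vert) : defect P y * P (baseVert x) = 0 := by
  rw [defect]
  split_ifs
  · exact h.orthogonal _ _ (baseVert_ne_copyVert _ _).symm
  · exact zero_mul _

theorem defect_mul_defect {x y : (E.periodGraph n).Vert} (hxy : x ≠ y) :
    defect P x * defect P y = 0 := by
  rw [defect, defect]
  split_ifs with hx hy
  · refine h.orthogonal _ _ fun h' => hxy ?_
    rw [eq_remVert_nil hx, eq_remVert_nil hy, copyVert_injective h']
  all_goals simp

/-- The twin edges have different sources, so the mixed products vanish. -/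
theorem edgeElt_mul_star (p : (E.periodGraph n).Edge) :
    edgeElt S p * star (edgeElt S p) = S (baseEdge p) * star (S (baseEdge p)) +
      if ((E.periodGraph n).s p).1.length = 0 then
        S (srcEdge n (copyEdge p)) * star (S (srcEdge n (copyEdge p))) else 0 := by
  rw [edgeElt]
  split_ifs
  · have h1 : S (baseEdge p) * star (S (srcEdge n (copyEdge p))) = 0 :=
      h.mul_star_of_ne (baseVert_ne_copyVert _ _)
    have h2 : S (srcEdge n (copyEdge p)) * star (S (baseEdge p)) = 0 :=
      h.mul_star_of_ne (baseVert_ne_copyVert _ _).symm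
    rw [star_add, add_mul, mul_add, mul_add, h1, h2, add_zero, zero_add]
  · simp

/-- R − Q is the projection of the original vertex x. Its Cuntz–Krieger relation, available because
x receives an edge, becomes the Toeplitz relation once each edge from a copy is merged with its
twin. -/
theorem isToeplitzFamily (hE : E.NoSources) :
    IsToeplitzFamily (edgeElt S) (vertElt P) (defect P) where
  isProj x := by
    refine ⟨?_, (h.isProj _).isSelfAdjoint.add (h.isProj_defect x).isSelfAdjoint⟩
    change (_ + _) * (_ + _) = _
    rw [add_mul, mul_add, mul_add, h.proj_mul_defect, h.defect_mul_proj,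
      (h.isProj _).isIdempotentElem.eq, (h.isProj_defect x).isIdempotentElem.eq, add_zero,
      zero_add, vertElt]
  orthogonal x y hxy := by
    rw [vertElt, vertElt, add_mul, mul_add, mul_add, h.proj_mul_defect, h.defect_mul_proj,
      h.defect_mul_defect hxy, h.orthogonal _ _ (baseVert_injective.ne hxy)]
    simp
  isProj_defect := h.isProj_defect
  defect_mul x := by
    rw [vertElt, mul_add, h.defect_mul_proj, (h.isProj_defect x).isIdempotentElem.eq, zero_add]
  defect_eq_zero x hx := if_neg hx
  star_edge_mul p q hpq := by
    have h1 : star (S (baseEdge p)) * S (baseEdge q) = 0 := h.star_mul _ _ (baseEdge_injective.ne hpq)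
    rw [edgeElt, edgeElt, star_add, add_mul, mul_add, mul_add, h1]
    split_ifs with hp hq hq
    · rw [h.star_mul _ _ (baseEdge_ne_srcEdge _ _), h.star_mul _ _ (baseEdge_ne_srcEdge _ _).symm,
        h.star_mul _ _ (srcEdge_injective.ne ?_)]
      · simp
      · intro h'
        refine hpq ?_
        rw [← edgeOfCopy_copyEdge hp, ← edgeOfCopy_copyEdge hq, h']
    · rw [h.star_mul _ _ (baseEdge_ne_srcEdge _ _)]
      simp
    · rw [h.star_mul _ _ (baseEdge_ne_srcEdge _ _).symm]
      simp
    · simp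
  star_edge_mul_self p := by
    rw [edgeElt, vertElt, defect]
    split_ifs
    · rw [star_add, add_mul, mul_add, mul_add, h.star_mul _ _ (baseEdge_ne_srcEdge _ _),
        h.star_mul _ _ (baseEdge_ne_srcEdge _ _).symm, h.star_mul_self, h.star_mul_self, add_zero,
        zero_add]
      rfl
    · rw [add_zero, add_zero, h.star_mul_self]
      rfl
  sum_mul_star x := by
    classical
    obtain ⟨p₀, hp₀⟩ := exists_edge_range_eq (n := n) hE x
    have := Fintype.ofFinite {p : E.Edge × E.Vert // E.s p.1 = p.2}
    have hsum := h.sum_mul_star (baseVert x) ⟨baseEdge p₀, congrArg baseVert hp₀⟩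
    rw [vertElt, add_sub_cancel_right, ← hsum]
    simp only [h.edgeElt_mul_star]
    rw [sum_edges_baseVert]
    rw [Finset.sum_add_distrib]
    congr 1
    rw [← Finset.sum_filter]
    refine Finset.sum_bij' (fun p _ => copyEdge p) (fun q _ => edgeOfCopy n q) ?_ ?_ ?_ ?_ ?_
    · intro p hp
      simp only [Finset.mem_filter, Finset.mem_univ, true_and] at hp ⊢
      rw [edgeOfCopy_copyEdge hp.2, hp.1]
    · intro q hq
      simp only [Finset.mem_filter, Finset.mem_univ, true_and] at hq ⊢
      exact ⟨hq, length_s_edgeOfCopy q⟩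
    · intro p hp
      simp only [Finset.mem_filter, Finset.mem_univ, true_and] at hp
      exact edgeOfCopy_copyEdge hp.2
    · intro q _
      exact copyEdge_edgeOfCopy q
    · intros
      rfl

theorem edgeElt_mul_proj_inl (p : (E.periodGraph n).Edge) :
    edgeElt S p * P (baseVert ((E.periodGraph n).s p)) = S (baseEdge p) := by
  rw [edgeElt, add_mul]
  have h1 : S (baseEdge p) * P (baseVert ((E.periodGraph n).s p)) = S (baseEdge p) := h.mul_proj_source _
  rw [h1, add_eq_left]
  split_ifs
  · exact h.mul_proj_of_ne (baseVert_ne_copyVert _ _)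
  · exact zero_mul _

theorem edgeElt_mul_proj_inr (q : {p : E.Edge × E.Vert // E.s p.1 = p.2}) :
    edgeElt S (edgeOfCopy n q) * P (copyVert n q.1.2) = S (srcEdge n q) := by
  rw [edgeElt, if_pos (length_s_edgeOfCopy q), copyEdge_edgeOfCopy, add_mul]
  have h1 : S (srcEdge n q) * P (copyVert n q.1.2) = S (srcEdge n q) := h.mul_proj_source _
  rw [h1, add_eq_right]
  exact h.mul_proj_of_ne (baseVert_ne_copyVert _ _).symm

/-- The elements of the Toeplitz family generate the whole Cuntz–Krieger family. -/
theorem adjoin_le (hE : E.NoSources) (hE' : E.NoSinks) :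
    NonUnitalStarAlgebra.adjoin ℂ (Set.range P ∪ Set.range S) ≤
      NonUnitalStarAlgebra.adjoin ℂ (Set.range (edgeElt S)) := by
  classical
  have hT := h.isToeplitzFamily hE
  have hV : ∀ p, edgeElt S p ∈ NonUnitalStarAlgebra.adjoin ℂ (Set.range (edgeElt S)) := fun p =>
    NonUnitalStarAlgebra.subset_adjoin ℂ _ ⟨p, rfl⟩
  have hR : ∀ x, vertElt P x ∈ NonUnitalStarAlgebra.adjoin ℂ (Set.range (edgeElt S)) := by
    intro x
    -- Without sinks some edge of E(n) starts at x, so R_x is an initial projection V_p⋆V_p.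
    obtain ⟨e, he⟩ := hE' x.1.range
    have h1 := hT.star_edge_mul_self (remEdge n e x.1 he)
    rw [s_remEdge, remVert_coe] at h1
    rw [← h1]
    exact mul_mem (star_mem (hV _)) (hV _)
  have hL : ∀ x, P (baseVert x) ∈ NonUnitalStarAlgebra.adjoin ℂ (Set.range (edgeElt S)) := by
    intro x
    have h1 := hT.sum_mul_star x
    rw [vertElt, add_sub_cancel_right] at h1
    rw [← h1]
    exact sum_mem fun p _ => mul_mem (hV _) (star_mem (hV _))
  have hQ : ∀ v, P (copyVert n v) ∈ NonUnitalStarAlgebra.adjoin ℂ (Set.range (edgeElt S)) := by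
    intro v
    have h1 : vertElt P ((nil v).remVert n) - P (baseVert ((nil v).remVert n)) = P (copyVert n v) := by
      rw [vertElt, add_sub_cancel_left, defect, remVert_nil_val, if_pos (length_nil v), range_nil]
    rw [← h1]
    exact sub_mem (hR _) (hL _)
  refine NonUnitalStarAlgebra.adjoin_le ?_
  rintro _ (⟨x, rfl⟩ | ⟨f, rfl⟩)
  on_goal 1 => obtain ⟨x, rfl⟩ | ⟨v, rfl⟩ := augVert_cases x
  on_goal 3 => obtain ⟨p, rfl⟩ | ⟨q, rfl⟩ := augEdge_cases f
  · exact hL x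
  · exact hQ v
  · rw [← h.edgeElt_mul_proj_inl]
    exact mul_mem (hV _) (hL _)
  · rw [← h.edgeElt_mul_proj_inr]
    exact mul_mem (hV _) (hQ _)

end IsCKFamily

end CuntzKrieger

/-! ### The Cuntz–Krieger E[n]-family on ℓ²(E*) -/

section FockFamily

open DirGraph.Path

variable {E : DirGraph.{u}} {n : ℕ} [NeZero n]

open Classical in
/-- The vertex of `E[n]` which describes a path: `c(v)` for the path `v` of length zero, and the
remainder for a longer path. -/
def pathVert (n : ℕ) [NeZero n] (z : E.Path) : (E.augPeriodGraph n).Vert :=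
  if z.length = 0 then copyVert n z.range else baseVert (z.remVert n)

/-- The edge of `E(n)` below an edge of `E[n]`. -/
def underEdge (f : (E.augPeriodGraph n).Edge) : (E.periodGraph n).Edge :=
  match f with
  | .inl p => p
  | .inr q => edgeOfCopy n q

theorem underEdge_baseEdge (p : (E.periodGraph n).Edge) : underEdge (baseEdge p) = p := rfl

theorem underEdge_srcEdge (q : {p : E.Edge × E.Vert // E.s p.1 = p.2}) :
    underEdge (srcEdge n q) = edgeOfCopy n q := rfl

theorem r_eq_baseVert (f : (E.augPeriodGraph n).Edge) :
    (E.augPeriodGraph n).r f = baseVert ((E.periodGraph n).r (underEdge f)) := by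
  rcases augEdge_cases f with ⟨p, rfl⟩ | ⟨q, rfl⟩
  · rfl
  · exact r_srcEdge q

theorem remVert_of_pathVert {z : E.Path} {f : (E.augPeriodGraph n).Edge}
    (h : pathVert n z = (E.augPeriodGraph n).s f) :
    z.remVert n = (E.periodGraph n).s (underEdge f) := by
  rw [pathVert] at h
  rcases augEdge_cases f with ⟨p, rfl⟩ | ⟨q, rfl⟩
  · rw [s_baseEdge] at h
    split_ifs at h
    · exact absurd h.symm (baseVert_ne_copyVert _ _)
    · exact baseVert_injective h
  · rw [s_srcEdge] at h
    split_ifs at h with hz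
    · rw [eq_nil_of_length_eq_zero hz, copyVert_injective h]
      rfl
    · exact absurd h (baseVert_ne_copyVert _ _)

theorem edge_eq_of_underEdge_eq {f g : (E.augPeriodGraph n).Edge}
    (h : (E.augPeriodGraph n).s f = (E.augPeriodGraph n).s g)
    (h' : underEdge f = underEdge g) : f = g := by
  rcases augEdge_cases f with ⟨p, rfl⟩ | ⟨q, rfl⟩ <;>
    rcases augEdge_cases g with ⟨p', rfl⟩ | ⟨q', rfl⟩
  · exact congrArg baseEdge h'
  · exact absurd h (baseVert_ne_copyVert _ _)
  · exact absurd h.symm (baseVert_ne_copyVert _ _)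
  · rw [underEdge_srcEdge, underEdge_srcEdge] at h'
    rw [← copyEdge_edgeOfCopy (n := n) q, h', copyEdge_edgeOfCopy]

open Classical in
/-- The partial bijection `w ↦ ew` of `E*` attached to an edge of `E[n]`. -/
def augShift (f : (E.augPeriodGraph n).Edge) : E.Path ≃. E.Path :=
  PEquiv.ofPartialInj
    (fun z => if pathVert n z = (E.augPeriodGraph n).s f then
      shiftPEquiv n (underEdge f) z else none)
    (by
      intro a a' b h h'
      split_ifs at h h'
      exact (shiftPEquiv n (underEdge f)).inj h h')

theorem augShift_eq_some_iff {f : (E.augPeriodGraph n).Edge} {z u : E.Path} :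
    augShift f z = some u ↔
      pathVert n z = (E.augPeriodGraph n).s f ∧ shiftPEquiv n (underEdge f) z = some u := by
  classical
  change ite _ _ _ = _ ↔ _
  split_ifs with h <;> simp [h]

theorem augShift_eq_none {f : (E.augPeriodGraph n).Edge} {z : E.Path}
    (h : pathVert n z ≠ (E.augPeriodGraph n).s f) : augShift f z = none := by
  classical
  exact if_neg h

theorem exists_augShift_of_pathVert {f : (E.augPeriodGraph n).Edge} {z : E.Path}
    (h : pathVert n z = (E.augPeriodGraph n).s f) : ∃ u, augShift f z = some u := by
  have h1 := remVert_of_pathVert h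
  exact ⟨_, augShift_eq_some_iff.2
    ⟨h, (shiftPEquiv_eq_some_iff n).2 ⟨s_eq_range_of_remVert_eq n h1, rfl, h1⟩⟩⟩

theorem pathVert_of_augShift {f : (E.augPeriodGraph n).Edge} {z u : E.Path}
    (h : augShift f z = some u) : pathVert n u = (E.augPeriodGraph n).r f := by
  have h1 := (augShift_eq_some_iff.1 h).2
  rw [pathVert, if_neg (by rw [length_of_shiftPEquiv n h1]; exact Nat.succ_ne_zero _),
    (remVert_of_shiftPEquiv n h1).2, r_eq_baseVert]

/-- The path u determines its predecessor z and the edge under f. Which of the two twins f is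
depends only on whether z has length zero. -/
theorem augShift_unique {f g : (E.augPeriodGraph n).Edge} {z y u : E.Path}
    (hf : augShift f z = some u) (hg : augShift g y = some u) : f = g ∧ z = y := by
  obtain ⟨h1, h2⟩ := augShift_eq_some_iff.1 hf
  obtain ⟨h3, h4⟩ := augShift_eq_some_iff.1 hg
  obtain ⟨h, rfl, h5⟩ := (shiftPEquiv_eq_some_iff n).1 h2
  obtain ⟨rfl, h6⟩ := (shiftPEquiv_eq_some_cons_iff n).1 h4
  exact ⟨edge_eq_of_underEdge_eq (h1.symm.trans h3)
    (((remEdge_eq_iff n (h := h)).2 ⟨rfl, h5⟩).symm.trans h6.symm), rfl⟩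

theorem exists_augShift_eq_cons (e : E.Edge) (z : E.Path) (h : E.s e = z.range) :
    ∃ f : (E.augPeriodGraph n).Edge, augShift f z = some (cons e z h) := by
  by_cases hz : z.length = 0
  · have hz' := eq_nil_of_length_eq_zero hz
    refine ⟨srcEdge n ⟨(e, z.range), h⟩, augShift_eq_some_iff.2 ⟨if_pos hz, ?_⟩⟩
    rw [underEdge_srcEdge, shiftPEquiv_eq_some_cons_iff]
    refine ⟨rfl, ((remEdge_eq_iff n).2 ⟨rfl, ?_⟩).symm⟩
    exact congrArg (Path.remVert n) hz'
  · refine ⟨baseEdge (remEdge n e z h), augShift_eq_some_iff.2 ⟨if_neg hz, ?_⟩⟩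
    rw [underEdge_baseEdge, shiftPEquiv_remEdge]

open Classical in
/-- The vertex projections of the Cuntz–Krieger `E[n]`-family on the Fock space. -/
def fockP (x : (E.augPeriodGraph n).Vert) : E.FockSpace →L[ℂ] E.FockSpace :=
  pequivOp (PEquiv.ofSet {z | pathVert n z = x})

/-- The edge operators of the Cuntz–Krieger `E[n]`-family on the Fock space. -/
def fockS (f : (E.augPeriodGraph n).Edge) : E.FockSpace →L[ℂ] E.FockSpace :=
  pequivOp (augShift f)

open Classical in
theorem fockP_xi (x : (E.augPeriodGraph n).Vert) (z : E.Path) :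
    fockP x (xi z) = if pathVert n z = x then xi z else 0 := by
  rw [fockP, pequivOp_xi]
  change (if z ∈ {z | pathVert n z = x} then some z else none).elim 0 xi = _
  simp only [Set.mem_ofPred_eq]
  split_ifs <;> rfl

theorem fockS_xi_of_some {f : (E.augPeriodGraph n).Edge} {z u : E.Path}
    (h : augShift f z = some u) : fockS f (xi z) = xi u := by
  rw [fockS, pequivOp_xi, h, Option.elim_some]

theorem fockS_xi_of_ne {f : (E.augPeriodGraph n).Edge} {z : E.Path}
    (h : pathVert n z ≠ (E.augPeriodGraph n).s f) : fockS f (xi z) = 0 := by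
  rw [fockS, pequivOp_xi, augShift_eq_none h, Option.elim_none]

theorem star_fockS_xi_of_some {f : (E.augPeriodGraph n).Edge} {z u : E.Path}
    (h : augShift f z = some u) : star (fockS f) (xi u) = xi z := by
  rw [fockS, star_pequivOp, pequivOp_xi, (PEquiv.eq_some_iff _).2 h, Option.elim_some]

theorem star_fockS_xi_of_forall_ne {f : (E.augPeriodGraph n).Edge} {u : E.Path}
    (h : ∀ z, augShift f z ≠ some u) : star (fockS f) (xi u) = 0 := by
  rw [fockS, star_pequivOp, pequivOp_xi]
  rcases hz : (augShift f).symm u with _ | z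
  · rfl
  · exact absurd ((PEquiv.eq_some_iff _).1 hz) (h z)

variable [Finite E.Vert] [Finite E.Edge]

/-- Every path of positive length has a unique predecessor and edge of E[n], which gives the
summation relation. Paths of length zero belong to the copies c(v), which receive no edge, so no
such relation is required there. -/
theorem isCKFamily_fock :
    (E.augPeriodGraph n).IsCKFamily (fockP (E := E) (n := n)) fockS where
  isProj x := by
    classical
    refine ⟨?_, ?_⟩
    · refine ext_xi fun z => ?_
      rw [mul_apply_eq_comp, fockP_xi]
      split_ifs with h
      · rw [fockP_xi, if_pos h]
      · rw [map_zero]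
    · rw [isSelfAdjoint_iff, fockP, star_pequivOp, PEquiv.ofSet_symm]
  orthogonal x y hxy := by
    classical
    refine ext_xi fun z => ?_
    rw [mul_apply_eq_comp, fockP_xi]
    split_ifs with h
    · rw [fockP_xi, if_neg (by rw [h]; exact hxy.symm)]
      rfl
    · rw [map_zero]
      rfl
  star_mul e f hef := by
    refine ext_xi fun z => ?_
    rw [mul_apply_eq_comp]
    by_cases h : pathVert n z = (E.augPeriodGraph n).s f
    · obtain ⟨u, hu⟩ := exists_augShift_of_pathVert h
      rw [fockS_xi_of_some hu, star_fockS_xi_of_forall_ne]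
      · rfl
      · intro y hy
        exact hef (augShift_unique hy hu).1
    · rw [fockS_xi_of_ne h, map_zero]
      rfl
  star_mul_self f := by
    classical
    refine ext_xi fun z => ?_
    rw [mul_apply_eq_comp, fockP_xi]
    split_ifs with h
    · obtain ⟨u, hu⟩ := exists_augShift_of_pathVert h
      rw [fockS_xi_of_some hu, star_fockS_xi_of_some hu]
    · rw [fockS_xi_of_ne h, map_zero]
  sum_mul_star x := by
    classical
    rintro ⟨f₀, hf₀⟩
    refine ext_xi fun u => ?_
    rw [sum_apply, fockP_xi]
    simp only [mul_apply_eq_comp]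
    split_ifs with h
    · have hu : u.length ≠ 0 := by
        intro hu
        rw [pathVert, if_pos hu, ← hf₀, r_eq_baseVert] at h
        exact baseVert_ne_copyVert _ _ h.symm
      obtain ⟨e, z, he, rfl⟩ := exists_eq_cons_of_length_ne_zero hu
      obtain ⟨f, hf⟩ := exists_augShift_eq_cons (n := n) e z he
      rw [Finset.sum_eq_single f]
      · rw [star_fockS_xi_of_some hf, fockS_xi_of_some hf]
      · intro g _ hg
        rw [star_fockS_xi_of_forall_ne, map_zero]
        intro y hy
        exact hg (augShift_unique hy hf).1
      · intro hf'
        rw [Set.Finite.mem_toFinset, Set.mem_ofPred_eq, ← pathVert_of_augShift hf] at hf'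
        exact absurd h hf'
    · refine Finset.sum_eq_zero fun g hg => ?_
      rw [Set.Finite.mem_toFinset, Set.mem_ofPred_eq] at hg
      rw [star_fockS_xi_of_forall_ne, map_zero]
      intro y hy
      rw [pathVert_of_augShift hy] at h
      exact h hg

-- On a path whose remainder is the source of p exactly one twin acts: the copy edge if the path has
-- length zero, the original edge otherwise.
omit [Finite E.Vert] [Finite E.Edge] in
theorem edgeElt_fockS (p : (E.periodGraph n).Edge) :
    IsCKFamily.edgeElt fockS p = pequivOp (shiftPEquiv n p) := by
  refine ext_xi fun z => ?_
  rw [IsCKFamily.edgeElt, add_apply, pequivOp_xi]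
  by_cases hz : z.remVert n = (E.periodGraph n).s p
  · obtain ⟨u, hu⟩ : ∃ u, shiftPEquiv n p z = some u :=
      ⟨_, (shiftPEquiv_eq_some_iff n).2 ⟨s_eq_range_of_remVert_eq n hz, rfl, hz⟩⟩
    rw [hu, Option.elim_some]
    by_cases hl : z.length = 0
    · have hs : (E.periodGraph n).s p = (nil z.range).remVert n := by
        rw [← hz]
        exact congrArg _ (eq_nil_of_length_eq_zero hl)
      have hp : ((E.periodGraph n).s p).1.length = 0 := by
        rw [hs, remVert_nil_val]
        rfl
      have h1 : pathVert n z = copyVert n z.range := if_pos hl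
      have h2 : (copyEdge p).1.2 = z.range := by
        change ((E.periodGraph n).s p).1.range = _
        rw [hs, remVert_nil_val]
        rfl
      rw [if_pos hp, fockS_xi_of_ne (by rw [h1, s_baseEdge]; exact (baseVert_ne_copyVert _ _).symm),
        zero_add]
      refine fockS_xi_of_some (augShift_eq_some_iff.2 ⟨?_, ?_⟩)
      · rw [h1, s_srcEdge, h2]
      · rw [underEdge_srcEdge, edgeOfCopy_copyEdge hp, hu]
    · have h1 : pathVert n z = baseVert (z.remVert n) := if_neg hl
      rw [fockS_xi_of_some (augShift_eq_some_iff.2 ⟨by rw [h1, hz, s_baseEdge], hu⟩), add_eq_left]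
      split_ifs
      · exact fockS_xi_of_ne (by rw [h1, s_srcEdge]; exact baseVert_ne_copyVert _ _)
      · rfl
  · rw [shiftPEquiv_of_ne n hz, Option.elim_none, fockS_xi_of_ne
      fun h => hz (remVert_of_pathVert h), zero_add]
    split_ifs with hp
    · refine fockS_xi_of_ne fun h => hz ?_
      rw [remVert_of_pathVert h, underEdge_srcEdge, edgeOfCopy_copyEdge hp]
    · rfl

variable (E n) in
/-- The representation of `𝒪(E[n])` on the Fock space. -/
def fockRep : (E.augPeriodGraph n).CKProd →⋆ₙₐ[ℂ] (E.FockSpace →L[ℂ] E.FockSpace) :=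
  CKProd.coord (G := E.augPeriodGraph n)
    ⟨E.FockSpace →L[ℂ] E.FockSpace, fockP, fockS, isCKFamily_fock⟩

theorem fockRep_edgeElt (p : (E.periodGraph n).Edge) :
    fockRep E n (IsCKFamily.edgeElt (E.augPeriodGraph n).univS p) = pequivOp (shiftPEquiv n p) := by
  rw [← edgeElt_fockS, IsCKFamily.edgeElt, IsCKFamily.edgeElt, map_add]
  split_ifs
  · rfl
  · rw [map_zero]
    rfl

end FockFamily

/-! ### Generators of 𝒜(n) and isometry of the Fock representation -/

section ShiftAlgebra

open DirGraph.Path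

variable {E : DirGraph.{u}} {n : ℕ} [NeZero n]

theorem remEdge_rem (e : E.Edge) (z : E.Path) (h : E.s e = z.range)
    (h' : E.s e = (z.rem n).range) : remEdge n e (z.rem n) h' = remEdge n e z h :=
  (remEdge_eq_iff n).2 ⟨rfl, remVert_coe n (z.remVert n)⟩

/-- Each elementary shift belongs to an `n`-periodic weighted shift. -/
theorem exists_isWeightedShift_eq_pequivOp (p : (E.periodGraph n).Edge) :
    ∃ (lam : E.Path → ℂ) (T : E.Edge → (E.FockSpace →L[ℂ] E.FockSpace)) (e : E.Edge),
      IsPeriodic n lam ∧ IsWeightedShift lam T ∧ pequivOp (shiftPEquiv n p) = T e := by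
  classical
  -- The indicator of the range of the shift; at ez it depends only on e and z(n), hence it is
  -- periodic.
  let lam : E.Path → ℂ := fun u => if ∃ z, shiftPEquiv n p z = some u then 1 else 0
  have hlam : ∀ e z h, lam (cons e z h) = if p = remEdge n e z h then 1 else 0 := by
    intro e z h
    simp only [lam, shiftPEquiv_eq_some_cons_iff]
    congr 1
    simp
  refine ⟨lam, fun e => if e = p.1.1 then pequivOp (shiftPEquiv n p) else 0, p.1.1, ?_, ?_, ?_⟩
  · intro e z h
    rw [hlam, hlam, remEdge_rem]
  · intro e z
    refine ⟨fun h => ?_, fun h => ?_⟩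
    · rw [hlam]
      by_cases hp : p = remEdge n e z h
      · rw [if_pos hp, one_smul, hp]
        change (if e = e then _ else _ : E.FockSpace →L[ℂ] E.FockSpace) _ = _
        rw [if_pos rfl, pequivOp_xi, shiftPEquiv_remEdge, Option.elim_some]
      · rw [if_neg hp, zero_smul]
        change (if e = p.1.1 then _ else _ : E.FockSpace →L[ℂ] E.FockSpace) _ = _
        split_ifs with he
        · rw [pequivOp_xi, shiftPEquiv_of_ne, Option.elim_none]
          intro hz
          exact hp ((remEdge_eq_iff n).2 ⟨he, hz⟩).symm
        · rfl
    · change (if e = p.1.1 then _ else _ : E.FockSpace →L[ℂ] E.FockSpace) _ = _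
      split_ifs with he
      · rw [pequivOp_xi, shiftPEquiv_of_ne, Option.elim_none]
        intro hz
        rw [he] at h
        exact h (s_eq_range_of_remVert_eq n hz)
      · rfl
  · exact (if_pos rfl).symm

variable [Finite E.Vert] [Finite E.Edge]

open Classical in
/-- A periodic weighted shift is a linear combination of elementary shifts. -/
theorem IsWeightedShift.eq_sum {lam : E.Path → ℂ}
    {T : E.Edge → (E.FockSpace →L[ℂ] E.FockSpace)} (hlam : IsPeriodic n lam)
    (hT : IsWeightedShift lam T) (e : E.Edge) :
    T e = ∑ p : (E.periodGraph n).Edge,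
      (if p.1.1 = e then lam (cons p.1.1 p.1.2.1 p.2) else 0) • pequivOp (shiftPEquiv n p) := by
  refine ext_xi fun z => ?_
  rw [sum_apply]
  simp only [smul_apply, pequivOp_xi]
  by_cases h : E.s e = z.range
  -- Only the lifted edge of the extension acts on ξ_z, and periodicity turns the weight of ez into
  -- the coefficient of that edge.
  · rw [(hT e z).1 h, Finset.sum_eq_single (remEdge n e z h), shiftPEquiv_remEdge, hlam]
    · exact congrArg (· • xi (cons e z h)) (if_pos rfl).symm
    · intro p _ hp
      split_ifs with he
      · rw [shiftPEquiv_of_ne, Option.elim_none, smul_zero]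
        intro hz
        exact hp ((remEdge_eq_iff n).2 ⟨he.symm, hz⟩).symm
      · exact zero_smul _ _
    · simp
  · rw [(hT e z).2 h]
    refine (Finset.sum_eq_zero fun p _ => ?_).symm
    split_ifs with he
    · rw [shiftPEquiv_of_ne, Option.elim_none, smul_zero]
      intro hz
      rw [← he] at h
      exact h (s_eq_range_of_remVert_eq n hz)
    · exact zero_smul _ _

theorem shiftAlgebra_eq : E.shiftAlgebra n = (NonUnitalStarAlgebra.adjoin ℂ
    (Set.range fun p : (E.periodGraph n).Edge =>
      pequivOp (shiftPEquiv n p))).topologicalClosure := by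
  rw [shiftAlgebra]
  congr 1
  refine le_antisymm (NonUnitalStarAlgebra.adjoin_le ?_) (NonUnitalStarAlgebra.adjoin_le ?_)
  · rintro _ ⟨lam, T, e, hlam, hT, rfl⟩
    rw [SetLike.mem_coe, hT.eq_sum hlam]
    exact sum_mem fun p _ => SMulMemClass.smul_mem _
      (NonUnitalStarAlgebra.subset_adjoin ℂ _ ⟨p, rfl⟩)
  · rintro _ ⟨p, rfl⟩
    exact NonUnitalStarAlgebra.subset_adjoin ℂ _ (exists_isWeightedShift_eq_pequivOp p)

theorem graphAlgebra_augPeriodGraph_eq (hsource : E.NoSources) (hsink : E.NoSinks) :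
    (E.augPeriodGraph n).graphAlgebra = (NonUnitalStarAlgebra.adjoin ℂ
      (Set.range (IsCKFamily.edgeElt (E.augPeriodGraph n).univS))).topologicalClosure := by
  rw [graphAlgebra]
  congr 1
  refine le_antisymm ((E.augPeriodGraph n).isCKFamily_univ.adjoin_le hsource hsink)
    (NonUnitalStarAlgebra.adjoin_le ?_)
  rintro _ ⟨p, rfl⟩
  have hS : ∀ f, (E.augPeriodGraph n).univS f ∈ NonUnitalStarAlgebra.adjoin ℂ
      (Set.range (E.augPeriodGraph n).univP ∪ Set.range (E.augPeriodGraph n).univS) := fun f =>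
    NonUnitalStarAlgebra.subset_adjoin ℂ _ (Or.inr ⟨f, rfl⟩)
  rw [SetLike.mem_coe, IsCKFamily.edgeElt]
  split_ifs
  · exact add_mem (hS _) (hS _)
  · exact add_mem (hS _) (zero_mem _)

theorem continuous_fockRep : Continuous (fockRep E n) :=
  AddMonoidHomClass.continuous_of_bound (fockRep E n) 1 fun a => by
    rw [one_mul]
    exact NonUnitalStarAlgHom.norm_apply_le _ a

/-- The upper bound is automatic for ⋆-homomorphisms. The lower bound holds on the dense ⋆-algebra
generated by the Toeplitz elements and passes to the closure. -/
theorem norm_fockRep (hsource : E.NoSources) (hsink : E.NoSinks)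
    {a : (E.augPeriodGraph n).CKProd} (ha : a ∈ (E.augPeriodGraph n).graphAlgebra) :
    ‖fockRep E n a‖ = ‖a‖ := by
  refine le_antisymm (NonUnitalStarAlgHom.norm_apply_le _ a) ?_
  have hT := (E.augPeriodGraph n).isCKFamily_univ.isToeplitzFamily hsource
  rw [graphAlgebra_augPeriodGraph_eq hsource hsink] at ha
  have hclosed : IsClosed {a : (E.augPeriodGraph n).CKProd | ‖a‖ ≤ ‖fockRep E n a‖} :=
    isClosed_le continuous_norm continuous_fockRep.norm
  exact closure_minimal (fun b hb => hT.norm_le_of_map_edge (fockRep E n) fockRep_edgeElt hb)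
    hclosed ha

theorem fockRep_mem (hsource : E.NoSources) (hsink : E.NoSinks)
    {a : (E.augPeriodGraph n).CKProd} (ha : a ∈ (E.augPeriodGraph n).graphAlgebra) :
    fockRep E n a ∈ E.shiftAlgebra n := by
  rw [graphAlgebra_augPeriodGraph_eq hsource hsink] at ha
  rw [shiftAlgebra_eq]
  have h1 : NonUnitalStarAlgebra.adjoin ℂ
      (Set.range (IsCKFamily.edgeElt (E.augPeriodGraph n).univS)) ≤
      (NonUnitalStarAlgebra.adjoin ℂ (Set.range fun p : (E.periodGraph n).Edge =>
        pequivOp (shiftPEquiv n p))).comap (fockRep E n) := by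
    refine NonUnitalStarAlgebra.adjoin_le ?_
    rintro _ ⟨p, rfl⟩
    refine (NonUnitalStarSubalgebra.mem_comap _ _ _).2 ?_
    rw [fockRep_edgeElt]
    exact NonUnitalStarAlgebra.subset_adjoin ℂ _ ⟨p, rfl⟩
  exact map_mem_closure continuous_fockRep ha fun b hb => h1 hb

/-- An isometry from a complete space has closed range, and this range contains all elementary
shifts together with the ⋆-algebra they generate. -/
theorem exists_fockRep_eq (hsource : E.NoSources) (hsink : E.NoSinks)
    {T : E.FockSpace →L[ℂ] E.FockSpace} (hT : T ∈ E.shiftAlgebra n) :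
    ∃ a ∈ (E.augPeriodGraph n).graphAlgebra, fockRep E n a = T := by
  have hiso : Isometry fun a : (E.augPeriodGraph n).graphAlgebra => fockRep E n a.1 := by
    refine Isometry.of_dist_eq fun a b => ?_
    rw [dist_eq_norm, ← map_sub, norm_fockRep hsource hsink (sub_mem a.2 b.2), ← dist_eq_norm]
    rfl
  have hcl : IsClosed ((E.augPeriodGraph n).graphAlgebra : Set (E.augPeriodGraph n).CKProd) :=
    NonUnitalStarSubalgebra.isClosed_topologicalClosure _
  have : CompleteSpace (E.augPeriodGraph n).graphAlgebra := hcl.completeSpace_coe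
  have hrange := hiso.isClosedEmbedding.isClosed_range
  rw [shiftAlgebra_eq] at hT
  have h1 : NonUnitalStarAlgebra.adjoin ℂ (Set.range fun p : (E.periodGraph n).Edge =>
      pequivOp (shiftPEquiv n p)) ≤
      ((E.augPeriodGraph n).graphAlgebra).map (fockRep E n) := by
    refine NonUnitalStarAlgebra.adjoin_le ?_
    rintro _ ⟨p, rfl⟩
    refine NonUnitalStarSubalgebra.mem_map.2
      ⟨IsCKFamily.edgeElt (E.augPeriodGraph n).univS p, ?_, fockRep_edgeElt p⟩
    rw [graphAlgebra_augPeriodGraph_eq hsource hsink]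
    exact NonUnitalStarSubalgebra.le_topologicalClosure _
      (NonUnitalStarAlgebra.subset_adjoin ℂ _ ⟨p, rfl⟩)
  obtain ⟨a, ha⟩ := closure_minimal (fun S hS => by
    obtain ⟨a, ha, rfl⟩ := NonUnitalStarSubalgebra.mem_map.1 (h1 hS)
    exact ⟨⟨a, ha⟩, rfl⟩) hrange hT
  exact ⟨a.1, a.2, ha⟩

end ShiftAlgebra

end DirGraph

end

/-! ### The isomorphism -/

theorem mainTheorem7 (E : DirGraph) [Finite E.Vert] [Finite E.Edge]
    (hsource : E.NoSources) (hsink : E.NoSinks) (n : ℕ) [NeZero n] :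
    Nonempty (E.shiftAlgebra n ≃⋆ₐ[ℂ] (E.augPeriodGraph n).graphAlgebra) := by
  let φ : (E.augPeriodGraph n).graphAlgebra →⋆ₙₐ[ℂ] E.shiftAlgebra n :=
    NonUnitalStarAlgHom.codRestrict
      ((DirGraph.fockRep E n).comp
        (NonUnitalStarSubalgebraClass.subtype (E.augPeriodGraph n).graphAlgebra))
      (E.shiftAlgebra n) fun a => DirGraph.fockRep_mem hsource hsink a.2
  have hφ : Function.Bijective φ := by
    constructor
    · rw [injective_iff_map_eq_zero]
      intro a ha
      have h1 : DirGraph.fockRep E n a.1 = 0 := congrArg Subtype.val ha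
      refine Subtype.ext (norm_eq_zero.1 ?_)
      rw [← DirGraph.norm_fockRep hsource hsink a.2, h1, norm_zero]
    · rintro ⟨T, hT⟩
      obtain ⟨a, ha, rfl⟩ := DirGraph.exists_fockRep_eq hsource hsink hT
      exact ⟨⟨a, ha⟩, rfl⟩
  exact ⟨(StarAlgEquiv.ofBijective φ hφ).symm⟩
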